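/- Let $d,\alpha\in\mathbb N$ with $\alpha\ge 1$, and let $c_1,\dots,c_d$ be nonzero real numbers (for instance $c_k>0$). For $k=1,\dots,d$ let $\rho_k:\mathbb R\to\mathbb R$ be a monotonic Schwartz weight, i.e. a Schwartz function with $\rho_k(x)>0$ for all $x\in\mathbb R$ for which there is $K>0$ with $x\,\rho_k'(x)\le 0$ for all $x\in\mathbb R\setminus[-K,K]$; put $\rho(\boldsymbol x)=\prod_{k=1}^d\rho_k(x_k)$. Let $W^{\alpha,2}_{\rho_k}(\mathbb R)$ be the Hilbert space of functions $u:\mathbb R\to\mathbb C$ whose weak derivatives $u^{(\tau)}$, $0\le\tau\le\alpha$, exist and satisfy $\int_{\mathbb R}|u^{(\tau)}|^2\rho_k\,\mathrm dx<\infty$, with inner product $\sum_{\tau=0}^{\alpha}\int_{\mathbb R}\overline{u^{(\tau)}}\,w^{(\tau)}\rho_k\,\mathrm dx$. Let $\mathbb T$ be $[0,2\pi]$ with its end points identified and let $W^{\alpha,2}(\mathbb T)$ be the Hilbert space of functions $u:\mathbb T\to\mathbb C$ whose weak derivatives $u^{(\tau)}$, $0\le\tau\le\alpha$, with respect to smooth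 $2\pi$-periodic test functions exist and lie in $L^2(\mathbb T)$, with inner product $\sum_{\tau=0}^{\alpha}\int_{\mathbb T}\overline{u^{(\tau)}}\,w^{(\tau)}\,\mathrm d\theta$. All elements of these spaces are identified with their continuous representatives. Let $$W^{\alpha,2}_{\rho,\otimes}(\mathbb R^d)=\bigotimes_{k=1}^d W^{\alpha,2}_{\rho_k}(\mathbb R),\qquad W^{\alpha,2}_{\otimes}(\mathbb T^d)=\bigotimes_{k=1}^d W^{\alpha,2}(\mathbb T)$$ be the Hilbert space tensor products, regarded as spaces of functions of $d$ variables: the completion of the span of the products $u_1(x_1)\cdots u_d(x_d)$ in the norm induced by the inner product with $\langle u_1\otimes\cdots\otimes u_d,\,w_1\otimes\cdots\otimes w_d\rangle=\prod_k\langle u_k,w_k\rangle$, where the function represented by a Cauchy sequence is its pointwise limit. Let $\varphi(\theta)=-\cot(\theta/2)$, so that $\varphi'(\theta)=\frac{1}{2\sin^2(\theta/2)}$, and $\varphi_{\boldsymbol c}(\boldsymbol\theta)=\big(c_1\cot(\theta_1/2),\dots,c_d\cot(\theta_d/2)\big)$ for $\boldsymbol\theta\in(0,2\pi)^d$. Let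 $f\in W^{\alpha,2}_{\rho,\otimes}(\mathbb R^d)$ and $$g(\boldsymbol\theta)=f(\varphi_{\boldsymbol c}(\boldsymbol\theta))\,\rho(\varphi_{\boldsymbol c}(\boldsymbol\theta))\prod_{k=1}^d c_k\varphi'(\theta_k),\qquad \boldsymbol\theta\in(0,2\pi)^d,$$ extended by $0$ to the points of $\mathbb T^d$ that have a coordinate $\theta_k=0$. Then $g\in W^{\alpha,2}_{\otimes}(\mathbb T^d)$. -/

import Mathlib

open MeasureTheory Filter Topology
open scoped ContDiff SchwartzMap ComplexConjugate

instance twoPiPosFact : Fact (0 < 2 * Real.pi) := ⟨Real.two_pi_pos⟩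

noncomputable section

/-- The circle `𝕋`, i.e. `[0, 2π]` with its end points identified. -/
abbrev Circ : Type := AddCircle (2 * Real.pi)

/-! ### Monotonic Schwartz weights -/

/-- A real Schwartz function which is positive everywhere and satisfies `x ρ'(x) ≤ 0` outside some
interval `[-K, K]`. -/
def IsMonotonicSchwartzWeight (ρ : 𝓢(ℝ, ℝ)) : Prop :=
  (∀ x, 0 < ρ x) ∧ ∃ K : ℝ, 0 < K ∧ ∀ x, x ∉ Set.Icc (-K) K → x * deriv ρ x ≤ 0

/-! ### Weak derivatives and Sobolev spaces on the line -/

/-- `v` is a weak derivative of order `τ` of `u` on `ℝ`. -/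
def HasWeakDeriv (τ : ℕ) (u v : ℝ → ℂ) : Prop :=
  LocallyIntegrable u ∧ LocallyIntegrable v ∧
    ∀ ψ : ℝ → ℝ, ContDiff ℝ ∞ ψ → HasCompactSupport ψ →
      ∫ x, ψ x • v x = (-1 : ℂ) ^ τ * ∫ x, iteratedDeriv τ ψ x • u x

open Classical in
/-- The weak derivative of order `τ` on `ℝ` (a.e. unique where it exists). -/
def weakDeriv (τ : ℕ) (u : ℝ → ℂ) : ℝ → ℂ :=
  if h : ∃ v, HasWeakDeriv τ u v then h.choose else 0

/-- The weighted Sobolev space `W^{α,2}_ρ(ℝ)`, `α ≥ 1`, every element being given by its continuous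
representative. -/
def weightedSobolev (α : ℕ) (ρ : ℝ → ℝ) : Set (ℝ → ℂ) :=
  {u | Continuous u ∧ ∀ τ ≤ α, ∃ v, HasWeakDeriv τ u v ∧ Integrable fun x => ‖v x‖ ^ 2 * ρ x}

/-- The inner product of `W^{α,2}_ρ(ℝ)`. -/
def weightedSobolevInner (α : ℕ) (ρ : ℝ → ℝ) (u w : ℝ → ℂ) : ℂ :=
  ∑ τ ∈ Finset.range (α + 1), ∫ x, conj (weakDeriv τ u x) * weakDeriv τ w x * (ρ x : ℂ)

/-! ### Weak derivatives and Sobolev spaces on the circle -/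

/-- `v` is a weak derivative of order `τ` of `u` on the circle: the test functions are the smooth
`2π`-periodic functions. -/
def HasPeriodicWeakDeriv (τ : ℕ) (u v : Circ → ℂ) : Prop :=
  IntervalIntegrable (fun θ : ℝ => u θ) volume 0 (2 * Real.pi) ∧
  IntervalIntegrable (fun θ : ℝ => v θ) volume 0 (2 * Real.pi) ∧
    ∀ ψ : ℝ → ℝ, ContDiff ℝ ∞ ψ → Function.Periodic ψ (2 * Real.pi) →
      ∫ θ in (0 : ℝ)..(2 * Real.pi), ψ θ • v θ =
        (-1 : ℂ) ^ τ * ∫ θ in (0 : ℝ)..(2 * Real.pi), iteratedDeriv τ ψ θ • u θ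

open Classical in
/-- The weak derivative of order `τ` on the circle (a.e. unique where it exists). -/
def periodicWeakDeriv (τ : ℕ) (u : Circ → ℂ) : Circ → ℂ :=
  if h : ∃ v, HasPeriodicWeakDeriv τ u v then h.choose else 0

/-- The periodic Sobolev space `W^{α,2}(𝕋)`, `α ≥ 1`, every element being given by its continuous
representative. -/
def periodicSobolev (α : ℕ) : Set (Circ → ℂ) :=
  {u | Continuous u ∧ ∀ τ ≤ α, ∃ v, HasPeriodicWeakDeriv τ u v ∧
    IntervalIntegrable (fun θ : ℝ => ‖v θ‖ ^ 2) volume 0 (2 * Real.pi)}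

/-- The inner product of `W^{α,2}(𝕋)`. -/
def periodicSobolevInner (α : ℕ) (u w : Circ → ℂ) : ℂ :=
  ∑ τ ∈ Finset.range (α + 1), ∫ θ in (0 : ℝ)..(2 * Real.pi),
    conj (periodicWeakDeriv τ u θ) * periodicWeakDeriv τ w θ

/-! ### Tensor products of Hilbert spaces of functions -/

section Tensor

variable {X : Type*} {d : ℕ}

/-- A formal finite linear combination `∑ a_u (u₁ ⊗ ⋯ ⊗ u_d)` of elementary tensors of functions,
indexed by the tuples `u = (u₁, …, u_d)`. -/
abbrev FormalTensor (X : Type*) (d : ℕ) : Type _ := (Fin d → X → ℂ) →₀ ℂ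

/-- The function of `d` variables `x ↦ ∑ a_u u₁(x₁) ⋯ u_d(x_d)` given by a formal tensor. -/
def FormalTensor.eval (F : FormalTensor X d) (x : Fin d → X) : ℂ :=
  F.sum fun u a => a * ∏ k, u k (x k)

/-- The tensor product of the inner products `B k`: the sesquilinear form with
`⟨u₁ ⊗ ⋯ ⊗ u_d, w₁ ⊗ ⋯ ⊗ w_d⟩ = ∏ B k (u k) (w k)`. -/
def FormalTensor.inner (B : Fin d → (X → ℂ) → (X → ℂ) → ℂ) (F G : FormalTensor X d) : ℂ :=
  F.sum fun u a => G.sum fun w b => conj a * b * ∏ k, B k (u k) (w k)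

/-- The Hilbert space tensor product `⨂ₖ W k` of Hilbert spaces `W k` of functions with inner
products `B k` and continuous point evaluations, as a space of functions of `d` variables: the
(functional) completion of the linear span of the products `u₁(x₁) ⋯ u_d(x_d)`, `u k ∈ W k`, in the
tensor product norm. Its elements are the pointwise limits of the sequences in that span which are
Cauchy in this norm. -/
def tensorSpace (W : Fin d → Set (X → ℂ)) (B : Fin d → (X → ℂ) → (X → ℂ) → ℂ) :
    Set ((Fin d → X) → ℂ) :=
  {f | ∃ F : ℕ → FormalTensor X d,
    (∀ n, ∀ u ∈ (F n).support, ∀ k, u k ∈ W k) ∧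
    (∀ ε : ℝ, 0 < ε → ∃ N, ∀ m ≥ N, ∀ n ≥ N,
      (FormalTensor.inner B (F m - F n) (F m - F n)).re < ε ^ 2) ∧
    ∀ x, Tendsto (fun n => (F n).eval x) atTop (𝓝 (f x))}

end Tensor

/-- `W^{α,2}_{ρ,⊗}(ℝ^d) = ⨂ₖ W^{α,2}_{ρ_k}(ℝ)`. -/
def weightedSobolevTensor {d : ℕ} (α : ℕ) (ρ : Fin d → ℝ → ℝ) : Set ((Fin d → ℝ) → ℂ) :=
  tensorSpace (fun k => weightedSobolev α (ρ k)) (fun k => weightedSobolevInner α (ρ k))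

/-- `W^{α,2}_⊗(𝕋^d) = ⨂ₖ W^{α,2}(𝕋)`. -/
def periodicSobolevTensor (d α : ℕ) : Set ((Fin d → Circ) → ℂ) :=
  tensorSpace (fun _ => periodicSobolev α) (fun _ => periodicSobolevInner α)

/-! ### The Möbius transformation -/

/-- `φ(θ) = -cot(θ/2)`, the Möbius transformation with unit scaling; `φ'(θ) = 1 / (2 sin²(θ/2))`. -/
def mobius (θ : ℝ) : ℝ := -Real.cot (θ / 2)

/-- The componentwise transformation `φ_c(θ) = (c₁ cot(θ₁/2), …, c_d cot(θ_d/2))`. -/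
def mobiusMap {d : ℕ} (c θ : Fin d → ℝ) : Fin d → ℝ := fun k => c k * Real.cot (θ k / 2)

/-- `g(θ) = f(φ_c(θ)) ρ(φ_c(θ)) ∏ c_k φ'(θ_k)` for `θ ∈ (0, 2π)^d`, with `ρ(x) = ∏ ρ_k(x_k)`. -/
def transformedIntegrand {d : ℕ} (c : Fin d → ℝ) (ρ : Fin d → ℝ → ℝ) (f : (Fin d → ℝ) → ℂ)
    (θ : Fin d → ℝ) : ℂ :=
  f (mobiusMap c θ) * ((∏ k, ρ k (mobiusMap c θ k) : ℝ) : ℂ) *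
    ((∏ k, c k * deriv mobius (θ k) : ℝ) : ℂ)

open Classical in
/-- A function on the open cube `(0, 2π)^d`, as a function on the torus `𝕋^d` that vanishes at the
points with a coordinate `0` (these form the image of the boundary of the cube). -/
def toTorus {d : ℕ} (g : (Fin d → ℝ) → ℂ) (θ : Fin d → Circ) : ℂ :=
  if ∃ k, θ k = 0 then 0
  else g fun k => (AddCircle.equivIco (2 * Real.pi) 0 (θ k) : ℝ)

end

/-! In one variable, put $x=c\cot(\theta/2)$ and $J(x)=(c^2+x^2)/(2c)$. Then
$c\,\varphi'(\theta)=J(x)$ and $d/d\theta=-J\,d/dx$, so the transformation is $Tu=(J\rho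
u)(c\cot(\theta/2))$, and its derivative of order $\tau$ is $\sum_{j\le\tau}A_{\tau,j}u^{(j)}$. Each
$A_{\tau,j}$ is a sum of polynomials times derivatives of $\rho$. Since $d\theta=|J|^{-1}dx$ and
$|J|^{-1}\le 2/|c|$, the map $T$ is bounded from $W^{\alpha,2}_\rho(\mathbb R)$ to
$W^{\alpha,2}(\mathbb T)$ as soon as $A_{\tau,j}^2\le C\rho$.

The analytic core is therefore $(1+x^2)^m\,\rho^{(l)}(x)^2\le C\rho(x)$ for all $l,m$
(`IsMonotonicSchwartzWeight.sq_iteratedDeriv_le`). Iterating Landau's inequality $\sup|f'|^2\le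
4\sup|f|\,\sup|f''|$ on $[x,\infty)$ bounds the tail supremum of $|\rho^{(l)}|$ by a power, with any
exponent below $1$, of the tail supremum of $\rho$. Monotonicity of the tail replaces the latter by
a multiple of $\rho(x)$. The exponent $3/4$ leaves a spare factor $\rho^{1/2}$, which absorbs
polynomials.

The same bounds justify integration by parts against functions without compact support
(`HasWeakDeriv.integral_smul_eq`), so $\theta=0$ produces no boundary term for periodic test
functions. They also make $J\rho u$ vanish at $\pm\infty$, so $Tu$ is continuous on the circle.

For several variables, boundedness of each $T_k$ is written as a Loewner inequality $G'_k\le C_kG_k$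
between Gram matrices. The Schur product theorem multiplies these inequalities
(`posSemidef_prod_sub_prod`), so $\bigotimes_k T_k$ is bounded on formal tensors and preserves
Cauchy sequences. Pointwise limits are preserved because each $T_k$ is a substitution followed by
multiplication with a fixed function. -/

/-! ### Landau inequalities and the derivatives of a monotonic weight -/

/-- Landau's inequality on a half-line. -/
theorem sq_deriv_le_of_bounds {f : ℝ → ℝ} (hf : ContDiff ℝ 2 f) {x A B : ℝ}
    (hA : ∀ y, x ≤ y → |f y| ≤ A) (hB : ∀ y, x ≤ y → |iteratedDeriv 2 f y| ≤ B)
    {y : ℝ} (hy : x ≤ y) : (deriv f y) ^ 2 ≤ 4 * A * B := by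
  have hA0 : 0 ≤ A := (abs_nonneg _).trans (hA x le_rfl)
  have hB0 : 0 ≤ B := (abs_nonneg _).trans (hB x le_rfl)
  -- For $h>0$, Taylor's formula at $y$ gives $|f'(y)|h\le 2A+Bh^2/2$; for $h\le 0$ the claim is
  -- trivial. The quadratic is thus nonnegative on all of $\mathbb R$, and its discriminant
  -- $f'(y)^2-4AB$ is nonpositive.
  have key : ∀ h : ℝ, 0 ≤ (B / 2) * (h * h) + (-|deriv f y|) * h + 2 * A := by
    intro h
    rcases le_or_gt h 0 with hh | hh
    · have : 0 ≤ |deriv f y| * (-h) := mul_nonneg (abs_nonneg _) (by linarith)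
      nlinarith [mul_nonneg hB0 (mul_self_nonneg h)]
    · obtain ⟨ξ, hξ, h1⟩ := taylor_mean_remainder_lagrange_iteratedDeriv (n := 1)
        (show y ≠ y + h by linarith) (hf.contDiffOn)
      have hu : UniqueDiffOn ℝ (Set.uIcc y (y + h)) := uniqueDiffOn_uIcc (by linarith)
      have hd : derivWithin f (Set.uIcc y (y + h)) y = deriv f y :=
        (hf.differentiable (by norm_num) y).derivWithin (hu _ Set.left_mem_uIcc)
      rw [taylorWithinEval_succ, taylor_within_zero_eval] at h1
      simp only [zero_add, iteratedDerivWithin_one, hd] at h1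
      rw [Set.uIoo_of_lt (by linarith)] at hξ
      norm_num at h1
      have h2 := hA y hy
      have h3 := hA (y + h) (by linarith)
      have h4 := hB ξ (by linarith [hξ.1])
      have h5 : deriv f y * h = f (y + h) - f y - iteratedDeriv 2 f ξ * h ^ 2 / 2 := by
        linarith
      have h6 : |deriv f y| * h ≤ A + A + B * h ^ 2 / 2 := by
        rw [← abs_of_pos hh, ← abs_mul, abs_of_pos hh, h5]
        refine (abs_sub _ _).trans (add_le_add ((abs_sub _ _).trans (add_le_add h3 h2)) ?_)
        rw [abs_div, abs_mul, abs_of_nonneg (sq_nonneg h), abs_of_pos (zero_lt_two' ℝ)]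
        gcongr
      nlinarith
  have := discrim_le_zero key
  rw [discrim, neg_sq, sq_abs] at this
  nlinarith

/-- Boundedness is the case $n=0$. For the induction, raise $A_{l+1}^2\le 4A_lA_{l+2}$ to the power
$n+1$, bound $A_{l+2}^{n+1}$ by $CA_{l+1}^n$ and cancel $A_{l+1}^n$. The gain is the exponent
$n/(n+1)$, which is as close to $1$ as desired. -/
theorem pow_succ_le_of_logConvex {X : Type*} {A : ℕ → X → ℝ} (h0 : ∀ l x, 0 ≤ A l x)
    (hb : ∀ l, ∃ M, ∀ x, A l x ≤ M) (hc : ∀ l x, A (l + 1) x ^ 2 ≤ 4 * A l x * A (l + 2) x)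
    (n l : ℕ) : ∃ C, 0 ≤ C ∧ ∀ x, A (l + 1) x ^ (n + 1) ≤ C * A l x ^ n := by
  induction n generalizing l with
  | zero =>
    obtain ⟨M, hM⟩ := hb (l + 1)
    refine ⟨max M 0, le_max_right _ _, fun x => ?_⟩
    simpa using Or.inl (hM x)
  | succ n ih =>
    obtain ⟨C, hC, h⟩ := ih (l + 1)
    refine ⟨4 ^ (n + 1) * C, by positivity, fun x => ?_⟩
    rcases (h0 (l + 1) x).eq_or_lt with h1 | h1
    · rw [← h1]
      have := h0 l x
      simp only [ne_eq, Nat.add_eq_zero_iff, one_ne_zero, and_false, not_false_eq_true, zero_pow]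
      positivity
    · have h2 := pow_le_pow_left₀ (sq_nonneg _) (hc l x) (n + 1)
      have h3 := h x
      have h4 : 0 ≤ A l x := h0 l x
      refine le_of_mul_le_mul_right ?_ (pow_pos h1 n)
      calc A (l + 1) x ^ (n + 1 + 1) * A (l + 1) x ^ n = (A (l + 1) x ^ 2) ^ (n + 1) := by ring
        _ ≤ (4 * A l x * A (l + 2) x) ^ (n + 1) := h2
        _ = 4 ^ (n + 1) * A l x ^ (n + 1) * A (l + 2) x ^ (n + 1) := by ring
        _ ≤ 4 ^ (n + 1) * A l x ^ (n + 1) * (C * A (l + 1) x ^ n) := by gcongr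
        _ = _ := by ring

theorem le_rpow_of_logConvex {X : Type*} {A : ℕ → X → ℝ} (h0 : ∀ l x, 0 ≤ A l x)
    (hb : ∀ l, ∃ M, ∀ x, A l x ≤ M) (hc : ∀ l x, A (l + 1) x ^ 2 ≤ 4 * A l x * A (l + 2) x)
    (l : ℕ) : ∀ s : ℝ, 0 < s → s < 1 → ∃ C, 0 ≤ C ∧ ∀ x, A l x ≤ C * A 0 x ^ s := by
  induction l with
  | zero =>
    intro s hs hs1
    obtain ⟨M, hM⟩ := hb 0
    refine ⟨(max M 0) ^ (1 - s), by positivity, fun x => ?_⟩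
    have h1 : A 0 x ≤ max M 0 := (hM x).trans (le_max_left _ _)
    calc A 0 x = A 0 x ^ (1 - s) * A 0 x ^ s := by
          rw [← Real.rpow_add_of_nonneg (h0 0 x) (by linarith) hs.le]; simp
      _ ≤ _ := by
          gcongr
          · exact Real.rpow_nonneg (h0 0 x) _
          · exact h0 0 x
  | succ l ih =>
    intro s hs hs1
    -- This choice makes $s(n+1)/n<1$, so the induction hypothesis applies with that exponent; the
    -- passage from $l$ to $l+1$ costs the factor $n/(n+1)$ and brings it back to $s$.
    obtain ⟨n, hn⟩ := exists_nat_gt (s / (1 - s))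
    have hn0 : (0 : ℝ) < n := (div_pos hs (by linarith)).trans hn
    rw [div_lt_iff₀ (by linarith)] at hn
    obtain ⟨D, hD, h1⟩ := ih (s * (n + 1) / n) (by positivity) (by
      rw [div_lt_one hn0]; linarith)
    obtain ⟨C, hC, h2⟩ := pow_succ_le_of_logConvex h0 hb hc n l
    refine ⟨(C * D ^ n) ^ (1 / ((n : ℝ) + 1)), by positivity, fun x => ?_⟩
    have h3 : A (l + 1) x ^ (n + 1) ≤ C * D ^ n * (A 0 x ^ s) ^ (n + 1) := by
      refine (h2 x).trans ?_
      calc C * A l x ^ n ≤ C * (D * A 0 x ^ (s * (n + 1) / n)) ^ n := by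
            gcongr
            · exact h0 l x
            · exact h1 x
        _ = C * D ^ n * (A 0 x ^ s) ^ (n + 1) := by
            rw [mul_pow, ← mul_assoc]
            congr 1
            rw [← Real.rpow_natCast, ← Real.rpow_natCast, ← Real.rpow_mul (h0 0 x),
              ← Real.rpow_mul (h0 0 x)]
            congr 1
            push_cast
            field_simp
    refine le_of_pow_le_pow_left₀ (Nat.succ_ne_zero n)
      (mul_nonneg (by positivity) (Real.rpow_nonneg (h0 0 x) _)) ?_
    refine h3.trans (le_of_eq ?_)
    rw [mul_pow]
    congr 1
    rw [← Real.rpow_natCast _ n.succ, ← Real.rpow_mul (by positivity)]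
    push_cast
    rw [one_div_mul_cancel (by positivity), Real.rpow_one]

/-- The supremum of `|f^(l)|` over `[x, ∞)`. -/
noncomputable def tailSup (f : ℝ → ℝ) (l : ℕ) (x : ℝ) : ℝ :=
  ⨆ y : Set.Ici x, |iteratedDeriv l f y|

theorem le_tailSup {f : ℝ → ℝ} {l : ℕ} {M : ℝ} (hM : ∀ x, |iteratedDeriv l f x| ≤ M) {x y : ℝ}
    (h : x ≤ y) : |iteratedDeriv l f y| ≤ tailSup f l x :=
  le_ciSup (f := fun y : Set.Ici x => |iteratedDeriv l f y|)
    ⟨M, by rintro _ ⟨z, rfl⟩; exact hM z⟩ ⟨y, h⟩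

theorem tailSup_le {f : ℝ → ℝ} {l : ℕ} {M x : ℝ}
    (hM : ∀ y, x ≤ y → |iteratedDeriv l f y| ≤ M) : tailSup f l x ≤ M :=
  ciSup_le fun y => hM y y.2

theorem tailSup_nonneg (f : ℝ → ℝ) (l : ℕ) (x : ℝ) : 0 ≤ tailSup f l x :=
  Real.iSup_nonneg fun _ => abs_nonneg _

theorem tailSup_sq_le {f : ℝ → ℝ} (hf : ContDiff ℝ ∞ f)
    (hb : ∀ l, ∃ M, ∀ x, |iteratedDeriv l f x| ≤ M) (l : ℕ) (x : ℝ) :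
    tailSup f (l + 1) x ^ 2 ≤ 4 * tailSup f l x * tailSup f (l + 2) x := by
  have hnn : 0 ≤ 4 * tailSup f l x * tailSup f (l + 2) x :=
    mul_nonneg (mul_nonneg (by norm_num) (tailSup_nonneg _ _ _)) (tailSup_nonneg _ _ _)
  rw [← Real.le_sqrt (tailSup_nonneg _ _ _) hnn]
  refine tailSup_le fun y hy => ?_
  rw [Real.le_sqrt (abs_nonneg _) hnn, sq_abs, iteratedDeriv_succ]
  obtain ⟨M, hM⟩ := hb l
  obtain ⟨M', hM'⟩ := hb (l + 2)
  have hf2 : ContDiff ℝ 2 (iteratedDeriv l f) := by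
    rw [iteratedDeriv_eq_iterate]
    exact ContDiff.iterate_deriv' 2 l (contDiff_infty.1 hf _)
  refine sq_deriv_le_of_bounds hf2 (fun z hz => le_tailSup hM hz) (fun z hz => ?_) hy
  have : iteratedDeriv 2 (iteratedDeriv l f) = iteratedDeriv (l + 2) f := by
    simp only [iteratedDeriv_eq_iterate, ← Function.iterate_add_apply, add_comm]
  rw [this]
  exact le_tailSup hM' hz

/-- Beyond $K$ the function decreases. On $[0,K]$ it is bounded below by a positive minimum, against
which the global bound $M$ is a constant multiple. -/
theorem exists_le_mul_of_antitone_tail {f : ℝ → ℝ} (hf : Differentiable ℝ f) (hpos : ∀ x, 0 < f x)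
    {M : ℝ} (hM : ∀ x, f x ≤ M) {K : ℝ} (hK : 0 < K) (hd : ∀ x, K < x → deriv f x ≤ 0) :
    ∃ C, 0 ≤ C ∧ ∀ x y, 0 ≤ x → x ≤ y → f y ≤ C * f x := by
  obtain ⟨z, -, hz⟩ := isCompact_Icc.exists_isMinOn (Set.nonempty_Icc.2 hK.le)
    (hf.continuous.continuousOn (s := Set.Icc 0 K))
  have hanti : AntitoneOn f (Set.Ici K) := antitoneOn_of_deriv_nonpos (convex_Ici K)
    hf.continuous.continuousOn hf.differentiableOn (fun x hx => hd x (by simpa using hx))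
  have hM0 : 0 < M := (hpos 0).trans_le (hM 0)
  have hz0 := hpos z
  refine ⟨1 + M / f z, by positivity, fun x y hx hxy => ?_⟩
  have hx0 := hpos x
  rcases le_or_gt K x with h | h
  · have : f y ≤ f x := hanti h (h.trans hxy) hxy
    have h2 : 0 ≤ M / f z * f x := by positivity
    linarith
  · have h1 : f z ≤ f x := hz ⟨hx, h.le⟩
    have h2 : M ≤ M / f z * f x := by
      rw [div_mul_eq_mul_div, le_div_iff₀ hz0]; gcongr
    linarith [hM y]

theorem sq_iteratedDeriv_le_of_nonneg {f : ℝ → ℝ} (hf : ContDiff ℝ ∞ f) (hpos : ∀ x, 0 < f x)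
    (hb : ∀ k l : ℕ, ∃ M, ∀ x, (1 + x ^ 2) ^ k * |iteratedDeriv l f x| ≤ M)
    {K : ℝ} (hK : 0 < K) (hd : ∀ x, K < x → deriv f x ≤ 0) (l m : ℕ) :
    ∃ C, 0 ≤ C ∧ ∀ x, 0 ≤ x → (1 + x ^ 2) ^ m * iteratedDeriv l f x ^ 2 ≤ C * f x := by
  have hb' : ∀ l, ∃ M, ∀ x, |iteratedDeriv l f x| ≤ M := fun l => by
    simpa using hb 0 l
  obtain ⟨M0, hM0⟩ := hb' 0
  simp only [iteratedDeriv_zero] at hM0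
  obtain ⟨C0, hC0, h0⟩ := exists_le_mul_of_antitone_tail (hf.differentiable (by norm_num)) hpos
    (fun x => (le_abs_self _).trans (hM0 x)) hK hd
  -- Squaring the exponent $3/4$ gives $f^{3/2}=f\cdot f^{1/2}$: one factor is the required bound,
  -- the other is left for the polynomial weight. Decay of $f$ is then needed at order $2m$, because
  -- a square root of it is taken.
  obtain ⟨C1, hC1, h1⟩ := le_rpow_of_logConvex (tailSup_nonneg f)
    (fun l => (hb' l).imp fun M hM x => tailSup_le fun y _ => hM y)
    (tailSup_sq_le hf hb') l (3 / 4) (by norm_num) (by norm_num)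
  obtain ⟨M1, hM1⟩ := hb (2 * m) 0
  obtain ⟨M2, hM2⟩ := hb' l
  refine ⟨C1 ^ 2 * (C0 ^ (3 / 2 : ℝ)) * M1 ^ (1 / 2 : ℝ), ?_, fun x hx => ?_⟩
  · have : 0 ≤ M1 := le_trans (by positivity) (hM1 0)
    positivity
  have hfx := hpos x
  have h2 : |iteratedDeriv l f x| ≤ C1 * (C0 * f x) ^ (3 / 4 : ℝ) := by
    refine (le_tailSup hM2 le_rfl).trans ((h1 x).trans ?_)
    gcongr
    · exact tailSup_nonneg _ _ _
    · exact tailSup_le fun y hy => by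
        rw [iteratedDeriv_zero, abs_of_pos (hpos y)]; exact h0 x y hx hy
  have h3 : (1 + x ^ 2) ^ m * f x ^ (1 / 2 : ℝ) ≤ M1 ^ (1 / 2 : ℝ) := by
    have h4 := hM1 x
    rw [iteratedDeriv_zero, abs_of_pos hfx, mul_comm 2 m, pow_mul] at h4
    have h5 := Real.rpow_le_rpow (by positivity) h4 (by norm_num : (0 : ℝ) ≤ 1 / 2)
    rwa [Real.mul_rpow (by positivity) hfx.le, ← Real.sqrt_eq_rpow, Real.sqrt_sq (by positivity)] at h5
  have h6 : ((C0 * f x) ^ (3 / 4 : ℝ)) ^ 2 = C0 ^ (3 / 2 : ℝ) * (f x * f x ^ (1 / 2 : ℝ)) := by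
    rw [← Real.rpow_natCast, ← Real.rpow_mul (by positivity), Real.mul_rpow hC0 hfx.le]
    norm_num
    left
    rw [← Real.rpow_one_add' hfx.le (by norm_num)]
    norm_num
  calc (1 + x ^ 2) ^ m * iteratedDeriv l f x ^ 2
      = (1 + x ^ 2) ^ m * |iteratedDeriv l f x| ^ 2 := by rw [sq_abs]
    _ ≤ (1 + x ^ 2) ^ m * (C1 * (C0 * f x) ^ (3 / 4 : ℝ)) ^ 2 := by gcongr
    _ = C1 ^ 2 * C0 ^ (3 / 2 : ℝ) * ((1 + x ^ 2) ^ m * f x ^ (1 / 2 : ℝ)) * f x := by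
        rw [mul_pow, h6]; ring
    _ ≤ _ := by gcongr

theorem IsMonotonicSchwartzWeight.sq_iteratedDeriv_le {ρ : 𝓢(ℝ, ℝ)}
    (hρ : IsMonotonicSchwartzWeight ρ) (l m : ℕ) :
    ∃ C, 0 ≤ C ∧ ∀ x, (1 + x ^ 2) ^ m * iteratedDeriv l ρ x ^ 2 ≤ C * ρ x := by
  obtain ⟨hpos, K, hK, hd⟩ := hρ
  have hsm : ContDiff ℝ ∞ ρ := ρ.smooth _
  have hb : ∀ k l : ℕ, ∃ M, ∀ x, (1 + x ^ 2) ^ k * |iteratedDeriv l ρ x| ≤ M := by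
    intro k l
    refine ⟨2 ^ (2 * k) * ((Finset.Iic (2 * k, l)).sup fun m => SchwartzMap.seminorm ℝ m.1 m.2) ρ,
      fun x => ?_⟩
    have := ρ.one_add_le_sup_seminorm_apply (𝕜 := ℝ) (m := (2 * k, l)) (k := 2 * k) (n := l)
      le_rfl le_rfl x
    rw [norm_iteratedFDeriv_eq_norm_iteratedDeriv, Real.norm_eq_abs, Real.norm_eq_abs] at this
    refine le_trans ?_ this
    rw [pow_mul]
    gcongr
    nlinarith [abs_nonneg x, sq_abs x]
  obtain ⟨C1, hC1, h1⟩ := sq_iteratedDeriv_le_of_nonneg hsm hpos hb hK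
    (fun x hx => by
      have := hd x (fun h => by linarith [h.2])
      by_contra! h
      nlinarith [mul_pos (hK.trans hx) h]) l m
  -- The negative half-line follows by reflection: $x\rho'(x)\le0$ makes $\rho(-x)$ decrease for
  -- $x>K$ as well.
  obtain ⟨C2, hC2, h2⟩ := sq_iteratedDeriv_le_of_nonneg (f := fun x => ρ (-x))
    (hsm.comp contDiff_neg) (fun x => hpos _)
    (fun k l => by
      obtain ⟨M, hM⟩ := hb k l
      refine ⟨M, fun x => ?_⟩
      rw [iteratedDeriv_comp_neg, smul_eq_mul, abs_mul, abs_pow]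
      simpa using hM (-x)) hK
    (fun x hx => by
      have := hd (-x) (fun h => by linarith [h.1])
      rw [deriv_comp_neg]
      by_contra! h
      nlinarith [mul_pos (hK.trans hx) h]) l m
  refine ⟨C1 + C2, by positivity, fun x => ?_⟩
  have hx0 := hpos x
  rcases le_total 0 x with hx | hx
  · have := h1 x hx
    nlinarith [mul_nonneg hC2 hx0.le]
  · have := h2 (-x) (by linarith)
    rw [iteratedDeriv_comp_neg, smul_eq_mul, mul_pow, ← pow_mul, mul_comm l 2, pow_mul] at this
    simp only [neg_neg, neg_sq, one_pow, one_mul] at this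
    nlinarith [mul_nonneg hC1 hx0.le]

/-! ### Coefficients dominated by the square root of a weight -/

/-- `a` is smooth and each derivative of `a` is `O(√ρ (1 + x²)^{-m})` for all `m`. -/
def RapidlyDominated (ρ a : ℝ → ℝ) : Prop :=
  ContDiff ℝ ∞ a ∧ ∀ l m : ℕ, ∃ C, 0 ≤ C ∧
    ∀ x, (1 + x ^ 2) ^ m * iteratedDeriv l a x ^ 2 ≤ C * ρ x

theorem IsMonotonicSchwartzWeight.rapidlyDominated {ρ : 𝓢(ℝ, ℝ)}
    (hρ : IsMonotonicSchwartzWeight ρ) : RapidlyDominated ρ ρ :=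
  ⟨ρ.smooth _, hρ.sq_iteratedDeriv_le⟩

namespace RapidlyDominated

variable {ρ a b : ℝ → ℝ}

theorem deriv (ha : RapidlyDominated ρ a) : RapidlyDominated ρ (deriv a) :=
  ⟨(contDiff_infty_iff_deriv.1 ha.1).2, fun l m => by
    simpa only [← iteratedDeriv_succ'] using ha.2 (l + 1) m⟩

theorem add (ha : RapidlyDominated ρ a) (hb : RapidlyDominated ρ b) :
    RapidlyDominated ρ fun x => a x + b x := by
  refine ⟨ha.1.add hb.1, fun l m => ?_⟩
  obtain ⟨C, hC, h⟩ := ha.2 l m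
  obtain ⟨D, hD, h'⟩ := hb.2 l m
  refine ⟨2 * (C + D), by positivity, fun x => ?_⟩
  rw [iteratedDeriv_fun_add (contDiff_infty.1 ha.1 l).contDiffAt (contDiff_infty.1 hb.1 l).contDiffAt]
  have hx : 0 ≤ (1 + x ^ 2) ^ m := by positivity
  nlinarith [h x, h' x,
    mul_nonneg hx (sq_nonneg (iteratedDeriv l a x - iteratedDeriv l b x))]

theorem const_mul (ha : RapidlyDominated ρ a) (r : ℝ) : RapidlyDominated ρ fun x => r * a x := by
  refine ⟨contDiff_const.mul ha.1, fun l m => ?_⟩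
  obtain ⟨C, hC, h⟩ := ha.2 l m
  refine ⟨r ^ 2 * C, by positivity, fun x => ?_⟩
  rw [iteratedDeriv_const_mul_field]
  nlinarith [mul_le_mul_of_nonneg_left (h x) (sq_nonneg r)]

theorem zero : RapidlyDominated ρ fun _ => 0 := by
  refine ⟨contDiff_const, fun l m => ⟨0, le_rfl, fun x => ?_⟩⟩
  rw [show (fun _ : ℝ => (0 : ℝ)) = fun x => 0 * (0 : ℝ) by simp, iteratedDeriv_const_mul_field]
  simp

theorem iteratedDeriv_id_mul {a : ℝ → ℝ} (ha : ContDiff ℝ ∞ a) (l : ℕ) :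
    iteratedDeriv (l + 1) (fun x => x * a x) =
      fun x => x * iteratedDeriv (l + 1) a x + (l + 1) * iteratedDeriv l a x := by
  have hd : ∀ l : ℕ, Differentiable ℝ (iteratedDeriv l a) := fun l =>
    ha.differentiable_iteratedDeriv l (by exact_mod_cast WithTop.coe_lt_top _)
  -- The truncated `l - 1` is harmless: at `l = 0` this is used only with `r = 0`.
  have key : ∀ (l : ℕ) (r x : ℝ), HasDerivAt
      (fun x => x * iteratedDeriv l a x + r * iteratedDeriv (l - 1) a x)
      (1 * iteratedDeriv l a x + x * iteratedDeriv (l + 1) a x +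
        r * iteratedDeriv (l - 1 + 1) a x) x := fun l r x => by
    have h1 := (hd l x).hasDerivAt
    have h2 := (hd (l - 1) x).hasDerivAt
    rw [← iteratedDeriv_succ] at h1 h2
    exact ((hasDerivAt_id x).mul h1).add (h2.const_mul r)
  induction l with
  | zero =>
    ext x
    have := (key 0 0 x).deriv
    simp only [iteratedDeriv_zero, zero_mul, add_zero, one_mul, zero_add] at this
    rw [zero_add, iteratedDeriv_one, this]
    simp [add_comm]
  | succ l ih =>
    rw [iteratedDeriv_succ, ih]
    ext x
    have := (key (l + 1) (l + 1) x).deriv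
    simp only [Nat.add_sub_cancel] at this
    rw [this]
    push_cast
    ring

/-- The Leibniz rule has only two terms, and the factor $x^2$ is paid for by one more power of
$1+x^2$. This is why domination is required for every $m$. -/
theorem id_mul (ha : RapidlyDominated ρ a) : RapidlyDominated ρ fun x => x * a x := by
  refine ⟨contDiff_id.mul ha.1, fun l m => ?_⟩
  have hx1 : ∀ x : ℝ, x ^ 2 ≤ 1 + x ^ 2 := fun x => by linarith
  cases l with
  | zero =>
    obtain ⟨C, hC, h⟩ := ha.2 0 (m + 1)
    refine ⟨C, hC, fun x => le_trans ?_ (h x)⟩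
    simp only [iteratedDeriv_zero]
    rw [mul_pow, pow_succ (1 + x ^ 2), mul_assoc]
    exact mul_le_mul_of_nonneg_left (mul_le_mul_of_nonneg_right (hx1 x) (sq_nonneg _))
      (by positivity)
  | succ l =>
    obtain ⟨C, hC, h⟩ := ha.2 (l + 1) (m + 1)
    obtain ⟨D, hD, h'⟩ := ha.2 l m
    refine ⟨2 * (C + (l + 1) ^ 2 * D), by positivity, fun x => ?_⟩
    rw [iteratedDeriv_id_mul ha.1]
    have hx : 0 ≤ (1 + x ^ 2) ^ m := by positivity
    have h1 := mul_le_mul_of_nonneg_left (h' x) (sq_nonneg ((l : ℝ) + 1))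
    have h2 := h x
    have h3 : (1 + x ^ 2) ^ m * (x * iteratedDeriv (l + 1) a x) ^ 2 ≤ C * ρ x := by
      refine le_trans ?_ h2
      rw [mul_pow, pow_succ (1 + x ^ 2), mul_assoc]
      exact mul_le_mul_of_nonneg_left (mul_le_mul_of_nonneg_right (hx1 x) (sq_nonneg _)) hx
    calc (1 + x ^ 2) ^ m * (x * iteratedDeriv (l + 1) a x + (l + 1) * iteratedDeriv l a x) ^ 2
        ≤ (1 + x ^ 2) ^ m * (2 * (x * iteratedDeriv (l + 1) a x) ^ 2 +
            2 * ((l + 1) * iteratedDeriv l a x) ^ 2) := by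
          gcongr
          nlinarith [sq_nonneg (x * iteratedDeriv (l + 1) a x - (l + 1) * iteratedDeriv l a x)]
      _ ≤ _ := by nlinarith

end RapidlyDominated

/-- `χ` is continuous and `O(√ρ (1 + x²)^{-1/2})`. -/
def RootDominated (ρ χ : ℝ → ℝ) : Prop :=
  Continuous χ ∧ ∃ C, ∀ x, (1 + x ^ 2) * χ x ^ 2 ≤ C * ρ x

theorem RapidlyDominated.rootDominated {ρ a : ℝ → ℝ} (ha : RapidlyDominated ρ a) :
    RootDominated ρ a := by
  obtain ⟨C, -, h⟩ := ha.2 0 1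
  exact ⟨ha.1.continuous, C, by simpa using h⟩

namespace RootDominated

variable {ρ χ ξ β : ℝ → ℝ} {v v' : ℝ → ℂ}

theorem bdd_mul (hχ : RootDominated ρ χ) (hβ : Continuous β) {B : ℝ} (hB : ∀ x, |β x| ≤ B) :
    RootDominated ρ fun x => β x * χ x := by
  obtain ⟨hc, C, h⟩ := hχ
  refine ⟨hβ.mul hc, B ^ 2 * C, fun x => ?_⟩
  have h1 : β x ^ 2 ≤ B ^ 2 := by
    rw [← sq_abs]; exact pow_le_pow_left₀ (abs_nonneg _) (hB x) 2
  have h2 : 0 ≤ (1 + x ^ 2) * χ x ^ 2 := by positivity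
  calc (1 + x ^ 2) * (β x * χ x) ^ 2 = β x ^ 2 * ((1 + x ^ 2) * χ x ^ 2) := by ring
    _ ≤ B ^ 2 * (C * ρ x) := mul_le_mul h1 (h x) h2 (sq_nonneg B)
    _ = _ := by ring

theorem add (hχ : RootDominated ρ χ) (hξ : RootDominated ρ ξ) :
    RootDominated ρ fun x => χ x + ξ x := by
  obtain ⟨hc, C, h⟩ := hχ
  obtain ⟨hc', D, h'⟩ := hξ
  refine ⟨hc.add hc', 2 * (C + D), fun x => ?_⟩
  have := h x
  have := h' x
  have : 0 ≤ (1 + x ^ 2) * (χ x - ξ x) ^ 2 := by positivity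
  nlinarith

theorem integrable_smul (hχ : RootDominated ρ χ) (hv : AEStronglyMeasurable v)
    (hv2 : Integrable fun x => ‖v x‖ ^ 2 * ρ x) : Integrable fun x => χ x • v x := by
  obtain ⟨hc, C, h⟩ := hχ
  refine Integrable.mono' (integrable_inv_one_add_sq.add (hv2.const_mul C))
    (hc.aestronglyMeasurable.smul hv) (Eventually.of_forall fun x => ?_)
  have hx : 0 < 1 + x ^ 2 := by positivity
  have h1 : (1 + x ^ 2) * χ x ^ 2 * ‖v x‖ ^ 2 ≤ C * ρ x * ‖v x‖ ^ 2 :=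
    mul_le_mul_of_nonneg_right (h x) (sq_nonneg _)
  rw [norm_smul, Real.norm_eq_abs, Pi.add_apply]
  -- Arithmetic–geometric mean: $2|\chi||v|\le(1+x^2)^{-1}+(1+x^2)\chi^2|v|^2$, where the last term
  -- is at most $C\rho|v|^2$.
  have h2 : 0 ≤ (1 + x ^ 2)⁻¹ * (1 - (1 + x ^ 2) * (|χ x| * ‖v x‖)) ^ 2 := by positivity
  have h3 : (1 + x ^ 2)⁻¹ * (1 - (1 + x ^ 2) * (|χ x| * ‖v x‖)) ^ 2 =
      (1 + x ^ 2)⁻¹ - 2 * (|χ x| * ‖v x‖) + (1 + x ^ 2) * χ x ^ 2 * ‖v x‖ ^ 2 := by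
    rw [← sq_abs (χ x)]; field_simp; ring
  have h4 : 0 ≤ |χ x| * ‖v x‖ := by positivity
  nlinarith

end RootDominated

/-! ### Integration by parts and decay at infinity on the line -/

theorem HasWeakDeriv.succ {τ : ℕ} {u v v' : ℝ → ℂ} (h : HasWeakDeriv τ u v)
    (h' : HasWeakDeriv (τ + 1) u v') : HasWeakDeriv 1 v v' := by
  refine ⟨h.2.1, h'.2.1, fun ψ hψ hc => ?_⟩
  rw [h'.2.2 ψ hψ hc, iteratedDeriv_one,
    h.2.2 (deriv ψ) (contDiff_infty_iff_deriv.1 hψ).2 hc.deriv, iteratedDeriv_succ', ← mul_assoc]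
  congr 1
  ring

/-- Integration by parts against test functions without compact support. -/
theorem HasWeakDeriv.integral_smul_eq {ρ χ : ℝ → ℝ} {v v' : ℝ → ℂ} (h : HasWeakDeriv 1 v v')
    (hv : Integrable fun x => ‖v x‖ ^ 2 * ρ x) (hv' : Integrable fun x => ‖v' x‖ ^ 2 * ρ x)
    (hχ : ContDiff ℝ ∞ χ) (h0 : RootDominated ρ χ) (h1 : RootDominated ρ (deriv χ)) :
    ∫ x, deriv χ x • v x = -∫ x, χ x • v' x := by
  -- The test function is cut off by $\beta(r_nx)$ with $r_n=1/(n+1)$. The extra term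
  -- $r_n\beta'(r_nx)\chi v$ tends to $0$, and multiples of $|\chi v'|$, $|\chi v|$ and $|\chi'v|$
  -- serve as majorants.
  let β : ContDiffBump (0 : ℝ) := ⟨1, 2, one_pos, one_lt_two⟩
  have hβ : ContDiff ℝ ∞ (β : ℝ → ℝ) := β.contDiff
  have hβc : HasCompactSupport (β : ℝ → ℝ) := β.hasCompactSupport
  have hβd : Continuous (deriv β) := (contDiff_infty_iff_deriv.1 hβ).2.continuous
  obtain ⟨B, hB⟩ := hβc.deriv.exists_bound_of_continuous hβd
  have hi0 := h0.integrable_smul h.1.aestronglyMeasurable hv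
  have hi0' := h0.integrable_smul h.2.1.aestronglyMeasurable hv'
  have hi1 := h1.integrable_smul h.1.aestronglyMeasurable hv
  let r : ℕ → ℝ := fun n => ((n : ℝ) + 1)⁻¹
  have hr0 : ∀ n, 0 < r n := fun n => by positivity
  have hr1 : ∀ n, r n ≤ 1 := fun n => inv_le_one_of_one_le₀ (by linarith [n.cast_nonneg (α := ℝ)])
  have hr : Tendsto r atTop (𝓝 0) := by
    simpa [r, one_div] using tendsto_one_div_add_atTop_nhds_zero_nat (𝕜 := ℝ)
  have hrx : ∀ x, Tendsto (fun n => r n * x) atTop (𝓝 0) := fun x => by simpa using hr.mul_const x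
  have hlim1 : ∀ x, Tendsto (fun n => β (r n * x)) atTop (𝓝 1) := fun x => by
    have := (hβ.continuous.tendsto 0).comp (hrx x)
    rwa [β.one_of_mem_closedBall (by simp [β])] at this
  have hlim0 : ∀ x, Tendsto (fun n => r n * deriv β (r n * x)) atTop (𝓝 0) := fun x => by
    simpa using hr.mul ((hβd.tendsto 0).comp (hrx x))
  have hbd : ∀ n x, HasDerivAt (fun x => β (r n * x) * χ x)
      (r n * deriv β (r n * x) * χ x + β (r n * x) * deriv χ x) x := fun n x => by
    have e1 : HasDerivAt (fun x => r n * x) (r n) x := by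
      simpa using (hasDerivAt_id x).const_mul (r n)
    have e2 := ((hβ.differentiable (by norm_num)) (r n * x)).hasDerivAt.comp x e1
    rw [mul_comm] at e2
    exact e2.mul ((hχ.differentiable (by norm_num)) x).hasDerivAt
  have hid : ∀ n, ∫ x, (β (r n * x) * χ x) • v' x =
      -∫ x, (r n * deriv β (r n * x) * χ x + β (r n * x) * deriv χ x) • v x := fun n => by
    have hc : HasCompactSupport fun x => β (r n * x) :=
      hβc.comp_homeomorph (Homeomorph.mulLeft₀ (r n) (hr0 n).ne')
    rw [h.2.2 (fun x => β (r n * x) * χ x)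
      ((hβ.comp (contDiff_const.mul contDiff_id)).mul hχ) hc.mul_right, iteratedDeriv_one,
      pow_one, neg_one_mul]
    congr 2
    ext x
    congr 1
    exact (hbd n x).deriv
  have hcβ : ∀ n, Continuous fun x => β (r n * x) := fun n =>
    hβ.continuous.comp (continuous_const.mul continuous_id)
  have hcβd : ∀ n, Continuous fun x => deriv β (r n * x) := fun n =>
    hβd.comp (continuous_const.mul continuous_id)
  have hβ1 : ∀ y, |β y| ≤ 1 := fun y => by
    rw [abs_of_nonneg β.nonneg]; exact β.le_one
  have L1 : Tendsto (fun n => ∫ x, (β (r n * x) * χ x) • v' x) atTop (𝓝 (∫ x, χ x • v' x)) := by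
    refine tendsto_integral_of_dominated_convergence (fun x => ‖χ x • v' x‖)
      (fun n => ((hcβ n).mul h0.1).aestronglyMeasurable.smul h.2.1.aestronglyMeasurable)
      hi0'.norm (fun n => Eventually.of_forall fun x => ?_) (Eventually.of_forall fun x => ?_)
    · rw [mul_smul, norm_smul]
      exact mul_le_of_le_one_left (norm_nonneg _) (hβ1 _)
    · simpa using ((hlim1 x).mul_const (χ x)).smul_const (v' x)
  have L2 : Tendsto (fun n => ∫ x, (r n * deriv β (r n * x) * χ x + β (r n * x) * deriv χ x) • v x)
      atTop (𝓝 (∫ x, deriv χ x • v x)) := by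
    refine tendsto_integral_of_dominated_convergence
      (fun x => B * ‖χ x • v x‖ + ‖deriv χ x • v x‖)
      (fun n => (((continuous_const.mul (hcβd n)).mul h0.1).add
        ((hcβ n).mul h1.1)).aestronglyMeasurable.smul h.1.aestronglyMeasurable)
      ((hi0.norm.const_mul B).add hi1.norm) (fun n => Eventually.of_forall fun x => ?_)
      (Eventually.of_forall fun x => ?_)
    · rw [add_smul, mul_smul (r n * _), mul_smul (β _)]
      refine (norm_add_le _ _).trans (add_le_add ?_ ?_)
      · rw [norm_smul]
        refine mul_le_mul_of_nonneg_right ?_ (norm_nonneg _)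
        rw [norm_mul, Real.norm_of_nonneg (hr0 n).le]
        have := hB (r n * x)
        nlinarith [norm_nonneg (deriv β (r n * x)), hr1 n]
      · rw [norm_smul (β _)]
        exact mul_le_of_le_one_left (norm_nonneg _) (hβ1 _)
    · simpa using (((hlim0 x).mul_const (χ x)).add ((hlim1 x).mul_const (deriv χ x))).smul_const (v x)
  have := tendsto_nhds_unique L1 (L2.neg.congr fun n => (hid n).symm)
  rw [this, neg_neg]

/-- The derivative of an ever steeper smooth step is an approximate identity: mass $1$ on
$[x,x+1/(n+1)]$. It recovers a boundary value when the equation for a weak derivative is tested with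
a step. -/
theorem integral_deriv_smoothTransition_smul {w : ℝ → ℂ} (hw : Continuous w) (x : ℝ) :
    Tendsto (fun n : ℕ => ∫ y, deriv (fun y => Real.smoothTransition (((n : ℝ) + 1) * (y - x))) y • w y)
      atTop (𝓝 (w x)) := by
  set s := Real.smoothTransition with hs
  have hsc : ContDiff ℝ ∞ s := Real.smoothTransition.contDiff
  have hsd : Continuous (deriv s) := (contDiff_infty_iff_deriv.1 hsc).2.continuous
  have hlt : ∀ t, t < 0 → deriv s t = 0 := fun t ht => by
    have : s =ᶠ[𝓝 t] fun _ => 0 := by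
      filter_upwards [Iio_mem_nhds ht] with y hy
      exact Real.smoothTransition.zero_of_nonpos (le_of_lt hy)
    rw [this.deriv_eq]; simp
  have hgt : ∀ t, 1 < t → deriv s t = 0 := fun t ht => by
    have : s =ᶠ[𝓝 t] fun _ => 1 := by
      filter_upwards [Ioi_mem_nhds ht] with y hy
      exact Real.smoothTransition.one_of_one_le (le_of_lt hy)
    rw [this.deriv_eq]; simp
  have hsupp : ∀ t, t ∉ Set.Icc (0 : ℝ) 1 → deriv s t = 0 := fun t ht => by
    by_contra h
    exact ht ⟨not_lt.1 fun h' => h (hlt t h'), not_lt.1 fun h' => h (hgt t h')⟩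
  have hcs : HasCompactSupport (deriv s) := HasCompactSupport.intro isCompact_Icc hsupp
  have hsi : Integrable (deriv s) := hsd.integrable_of_hasCompactSupport hcs
  have hone : ∫ t, deriv s t = 1 := by
    rw [integral_of_hasDerivAt_of_tendsto (f := s) (m := 0) (n := 1)
      (fun t => (hsc.differentiable (by norm_num) t).hasDerivAt) hsi]
    · simp
    · refine tendsto_const_nhds.congr' ?_
      filter_upwards [Iic_mem_atBot (0 : ℝ)] with y hy
      exact (Real.smoothTransition.zero_of_nonpos hy).symm
    · refine tendsto_const_nhds.congr' ?_
      filter_upwards [Ici_mem_atTop (1 : ℝ)] with y hy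
      exact (Real.smoothTransition.one_of_one_le hy).symm
  have hsubst : ∀ n : ℕ, ∫ y, deriv (fun y => s (((n : ℝ) + 1) * (y - x))) y • w y =
      ∫ t, deriv s t • w (x + ((n : ℝ) + 1)⁻¹ * t) := fun n => by
    have hn : (0 : ℝ) < n + 1 := by positivity
    have hd : ∀ y, deriv (fun y => s (((n : ℝ) + 1) * (y - x))) y =
        ((n : ℝ) + 1) * deriv s (((n : ℝ) + 1) * (y - x)) := fun y => by
      have e1 : HasDerivAt (fun y => ((n : ℝ) + 1) * (y - x)) ((n : ℝ) + 1) y := by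
        simpa using ((hasDerivAt_id y).sub_const x).const_mul ((n : ℝ) + 1)
      have := ((hsc.differentiable (by norm_num)) (((n : ℝ) + 1) * (y - x))).hasDerivAt.comp y e1
      rw [mul_comm]
      exact this.deriv
    let g : ℝ → ℂ := fun t => deriv s t • w (x + ((n : ℝ) + 1)⁻¹ * t)
    have h1 : ∀ y, deriv (fun y => s (((n : ℝ) + 1) * (y - x))) y • w y =
        ((n : ℝ) + 1) • g (((n : ℝ) + 1) * (y - x)) := fun y => by
      simp only [hd, g, mul_smul]
      rw [inv_mul_cancel_left₀ hn.ne', add_sub_cancel]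
    simp_rw [h1]
    rw [integral_smul, integral_sub_right_eq_self (fun z => g (((n : ℝ) + 1) * z)) x,
      Measure.integral_comp_mul_left, abs_of_pos (inv_pos.2 hn), smul_inv_smul₀ hn.ne']
  simp_rw [hsubst]
  obtain ⟨M, hM⟩ := (isCompact_Icc (a := x) (b := x + 1)).exists_bound_of_continuousOn
    hw.continuousOn
  have hlim : ∫ t, deriv s t • w x = w x := by
    rw [integral_smul_const, hone, one_smul]
  rw [← hlim]
  refine tendsto_integral_of_dominated_convergence (fun t => ‖deriv s t‖ * M)
    (fun n => (hsd.smul (hw.comp (by fun_prop))).aestronglyMeasurable)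
    (hsi.norm.mul_const M) (fun n => Eventually.of_forall fun t => ?_)
    (Eventually.of_forall fun t => ?_)
  · rw [norm_smul]
    by_cases ht : t ∈ Set.Icc (0 : ℝ) 1
    · refine mul_le_mul_of_nonneg_left (hM _ ?_) (norm_nonneg _)
      have h1 : ((n : ℝ) + 1)⁻¹ ≤ 1 := inv_le_one_of_one_le₀ (by linarith [n.cast_nonneg (α := ℝ)])
      have h0 : 0 ≤ ((n : ℝ) + 1)⁻¹ := by positivity
      exact ⟨by nlinarith [ht.1], by nlinarith [ht.1, ht.2]⟩
    · simp [hsupp t ht]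
  · refine ((hw.tendsto x).comp ?_).const_smul _
    have := (tendsto_one_div_add_atTop_nhds_zero_nat (𝕜 := ℝ)).mul_const t
    simpa [one_div] using this.const_add x

section Decay

variable {ρ a : ℝ → ℝ} {v v' : ℝ → ℂ}

/-- This is the fundamental theorem of calculus for $av$ on $[x,\infty)$ with no term at infinity.
As $v'$ is only a weak derivative, the indicator of $(x,\infty)$ is approximated by smooth steps
$H_n$, and $H_na$ is used as a test function. -/
theorem HasWeakDeriv.eq_neg_setIntegral (h : HasWeakDeriv 1 v v') (hvc : Continuous v)
    (hv : Integrable fun x => ‖v x‖ ^ 2 * ρ x) (hv' : Integrable fun x => ‖v' x‖ ^ 2 * ρ x)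
    (ha : RapidlyDominated ρ a) (x : ℝ) :
    a x • v x = -∫ y in Set.Ioi x, deriv a y • v y + a y • v' y := by
  have hac := ha.1.continuous
  have hw : Continuous fun y => a y • v y := hac.smul hvc
  have hi1 := ha.deriv.rootDominated.integrable_smul h.1.aestronglyMeasurable hv
  have hi2 := ha.rootDominated.integrable_smul h.2.1.aestronglyMeasurable hv'
  let H : ℕ → ℝ → ℝ := fun n y => Real.smoothTransition (((n : ℝ) + 1) * (y - x))
  have hH : ∀ n, ContDiff ℝ ∞ (H n) := fun n => Real.smoothTransition.contDiff.comp (by fun_prop)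
  have hHd : ∀ n, Continuous (deriv (H n)) := fun n =>
    (contDiff_infty_iff_deriv.1 (hH n)).2.continuous
  have hH1 : ∀ n y, |H n y| ≤ 1 := fun n y => by
    rw [abs_of_nonneg (Real.smoothTransition.nonneg _)]; exact Real.smoothTransition.le_one _
  have hneg : ∀ n y, y ≤ x → H n y = 0 := fun n y hy =>
    Real.smoothTransition.zero_of_nonpos
      (mul_nonpos_of_nonneg_of_nonpos (by positivity) (by linarith))
  have hHcs : ∀ n, HasCompactSupport (deriv (H n)) := fun n => by
    have hn : (0 : ℝ) < (n : ℝ) + 1 := by positivity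
    refine HasCompactSupport.intro (K := Set.Icc x (x + 1)) isCompact_Icc fun y hy => ?_
    rcases lt_or_ge y x with h' | h'
    · have : H n =ᶠ[𝓝 y] fun _ => 0 := by
        filter_upwards [Iio_mem_nhds h'] with z hz using hneg n z (le_of_lt hz)
      rw [this.deriv_eq]; simp
    · have h'' : x + 1 < y := not_le.1 fun h'' => hy ⟨h', h''⟩
      have : H n =ᶠ[𝓝 y] fun _ => 1 := by
        filter_upwards [Ioi_mem_nhds h''] with z hz
        have hz' : x + 1 < z := hz
        exact Real.smoothTransition.one_of_one_le (by nlinarith [n.cast_nonneg (α := ℝ)])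
      rw [this.deriv_eq]; simp
  have hder : ∀ n, deriv (fun y => H n y * a y) =
      fun y => deriv (H n) y * a y + H n y * deriv a y := fun n => by
    ext y
    exact (((hH n).differentiable (by norm_num) y).hasDerivAt.mul
      (ha.1.differentiable (by norm_num) y).hasDerivAt).deriv
  -- The Leibniz rule separates $H_n'av$, which concentrates at $x$, from $H_n(a'v+av')$, which
  -- converges to the integral over the half-line.
  have hparts : ∀ n, ∫ y, deriv (H n) y • (a y • v y) =
      -∫ y, H n y • (deriv a y • v y + a y • v' y) := fun n => by
    obtain ⟨B, hB⟩ := (hHcs n).exists_bound_of_continuous (hHd n)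
    have r0 := ha.rootDominated.bdd_mul (hH n).continuous (hH1 n)
    have r1 := ha.rootDominated.bdd_mul (hHd n) hB
    have r2 := ha.deriv.rootDominated.bdd_mul (hH n).continuous (hH1 n)
    have key := h.integral_smul_eq hv hv' ((hH n).mul ha.1) r0 (by rw [hder n]; exact r1.add r2)
    have i0 := r0.integrable_smul h.2.1.aestronglyMeasurable hv'
    have i1 := r1.integrable_smul h.1.aestronglyMeasurable hv
    have i2 := r2.integrable_smul h.1.aestronglyMeasurable hv
    simp only [hder n, add_smul] at key
    rw [integral_add i1 i2] at key
    simp only [smul_add, ← mul_smul]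
    rw [integral_add i2 i0, neg_add, ← key]
    ring
  have L1 := integral_deriv_smoothTransition_smul hw x
  have L2 : Tendsto (fun n => ∫ y, H n y • (deriv a y • v y + a y • v' y)) atTop
      (𝓝 (∫ y, (Set.Ioi x).indicator (fun y => deriv a y • v y + a y • v' y) y)) := by
    refine tendsto_integral_of_dominated_convergence (fun y => ‖deriv a y • v y + a y • v' y‖)
      (fun n => (hH n).continuous.aestronglyMeasurable.smul (hi1.add hi2).aestronglyMeasurable)
      (hi1.add hi2).norm (fun n => Eventually.of_forall fun y => ?_)
      (Eventually.of_forall fun y => ?_)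
    · rw [norm_smul]
      exact mul_le_of_le_one_left (norm_nonneg _) (hH1 n y)
    · by_cases hy : y ∈ Set.Ioi x
      · rw [Set.indicator_of_mem hy]
        refine tendsto_const_nhds.congr' ?_
        obtain ⟨N, hN⟩ := exists_nat_gt ((y - x)⁻¹)
        have hyx : 0 < y - x := sub_pos.2 hy
        filter_upwards [Ici_mem_atTop N] with n hn
        have hn' : (N : ℝ) ≤ n := by exact_mod_cast hn
        have h1 : H n y = 1 := Real.smoothTransition.one_of_one_le (by
          rw [inv_lt_iff_one_lt_mul₀ hyx] at hN
          nlinarith)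
        rw [h1, one_smul]
      · rw [Set.indicator_of_notMem hy]
        refine tendsto_const_nhds.congr fun n => ?_
        rw [hneg n y (not_lt.1 hy), zero_smul]
  rw [integral_indicator measurableSet_Ioi] at L2
  exact tendsto_nhds_unique L1 (L2.neg.congr fun n => (hparts n).symm)

theorem HasWeakDeriv.tendsto_smul_atTop (h : HasWeakDeriv 1 v v') (hvc : Continuous v)
    (hv : Integrable fun x => ‖v x‖ ^ 2 * ρ x) (hv' : Integrable fun x => ‖v' x‖ ^ 2 * ρ x)
    (ha : RapidlyDominated ρ a) : Tendsto (fun x => a x • v x) atTop (𝓝 0) := by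
  simp_rw [h.eq_neg_setIntegral hvc hv hv' ha]
  have := (tendsto_integral_Ioi_zero (f := fun y => deriv a y • v y + a y • v' y) (μ := volume)
    tendsto_id).neg
  rwa [neg_zero] at this

/-- The integral of $a'v+av'$ over the whole line is $0$, so minus the integral over $(x,\infty)$ is
the integral over $(-\infty,x]$, which vanishes as $x\to-\infty$. -/
theorem HasWeakDeriv.tendsto_smul_atBot (h : HasWeakDeriv 1 v v') (hvc : Continuous v)
    (hv : Integrable fun x => ‖v x‖ ^ 2 * ρ x) (hv' : Integrable fun x => ‖v' x‖ ^ 2 * ρ x)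
    (ha : RapidlyDominated ρ a) : Tendsto (fun x => a x • v x) atBot (𝓝 0) := by
  have hi1 := ha.deriv.rootDominated.integrable_smul h.1.aestronglyMeasurable hv
  have hi2 := ha.rootDominated.integrable_smul h.2.1.aestronglyMeasurable hv'
  have h0 : ∫ y, deriv a y • v y + a y • v' y = 0 := by
    rw [integral_add hi1 hi2, h.integral_smul_eq hv hv' ha.1 ha.rootDominated
      ha.deriv.rootDominated, neg_add_cancel]
  simp_rw [h.eq_neg_setIntegral hvc hv hv' ha]
  have := tendsto_integral_Iic_zero (f := fun y => deriv a y • v y + a y • v' y) (μ := volume)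
    tendsto_id
  refine this.congr fun x => ?_
  rw [eq_neg_iff_add_eq_zero, ← h0]
  exact intervalIntegral.integral_Iic_add_Ioi (hi1.add hi2).integrableOn (hi1.add hi2).integrableOn

end Decay

/-! ### The substitution `x = c cot(θ/2)` -/

/-- The Jacobian `-dx/dθ = (c² + x²) / (2c)` of `x = c cot(θ/2)`, as a function of `x`. -/
noncomputable def cotJacobian (c x : ℝ) : ℝ := (c ^ 2 + x ^ 2) / (2 * c)

/-- The inverse of `θ ↦ c cot(θ/2)` on `(0, 2π)`. -/
noncomputable def cotAngle (c x : ℝ) : ℝ := Real.pi - 2 * Real.arctan (x / c)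

section Substitution

variable {c : ℝ}

theorem cotJacobian_ne_zero (hc : c ≠ 0) (x : ℝ) : cotJacobian c x ≠ 0 := by
  have : 0 < c ^ 2 + x ^ 2 := by positivity
  exact div_ne_zero this.ne' (mul_ne_zero two_ne_zero hc)

theorem abs_cotJacobian (c x : ℝ) : |cotJacobian c x| = c / |c| * cotJacobian c x := by
  rcases eq_or_ne c 0 with rfl | hc
  · simp [cotJacobian]
  have : 0 < |c| := abs_pos.2 hc
  rw [cotJacobian, abs_div, abs_mul, abs_of_nonneg (by positivity), abs_two]
  field_simp

theorem abs_inv_cotJacobian_le (hc : c ≠ 0) (x : ℝ) : |(cotJacobian c x)⁻¹| ≤ 2 / |c| := by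
  have h : 0 < |c| := abs_pos.2 hc
  rw [cotJacobian, inv_div, abs_div, abs_mul, abs_two, abs_of_nonneg (by positivity : 0 ≤ c ^ 2 + x ^ 2),
    div_le_div_iff₀ (by positivity) h]
  nlinarith [sq_abs c, sq_nonneg x]

theorem contDiff_cotJacobian : ContDiff ℝ ∞ (cotJacobian c) := by
  unfold cotJacobian; fun_prop

theorem contDiff_cotAngle : ContDiff ℝ ∞ (cotAngle c) :=
  contDiff_const.sub (contDiff_const.mul (Real.contDiff_arctan.comp (contDiff_id.div_const c)))

theorem hasDerivAt_cotAngle (hc : c ≠ 0) (x : ℝ) :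
    HasDerivAt (cotAngle c) (-(cotJacobian c x)⁻¹) x := by
  have := (((Real.hasDerivAt_arctan (x / c)).comp x ((hasDerivAt_id x).div_const c)).const_mul
    2).const_sub Real.pi
  refine this.congr_deriv ?_
  have : 0 < c ^ 2 + x ^ 2 := by positivity
  rw [cotJacobian]
  field_simp

theorem cotAngle_mem (c x : ℝ) : cotAngle c x ∈ Set.Ioo 0 (2 * Real.pi) := by
  have h1 := Real.neg_pi_div_two_lt_arctan (x / c)
  have h2 := Real.arctan_lt_pi_div_two (x / c)
  constructor <;> rw [cotAngle] <;> linarith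

theorem cot_cotAngle (hc : c ≠ 0) (x : ℝ) : c * Real.cot (cotAngle c x / 2) = x := by
  have h : Real.cot (cotAngle c x / 2) = x / c := by
    rw [cotAngle, sub_div, mul_div_cancel_left₀ _ two_ne_zero, Real.cot_eq_cos_div_sin,
      Real.cos_pi_div_two_sub, Real.sin_pi_div_two_sub, ← Real.tan_eq_sin_div_cos, Real.tan_arctan]
  rw [h, mul_div_cancel₀ _ hc]

theorem cotAngle_cot (hc : c ≠ 0) {θ : ℝ} (hθ : θ ∈ Set.Ioo 0 (2 * Real.pi)) :
    cotAngle c (c * Real.cot (θ / 2)) = θ := by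
  have h : Real.cot (θ / 2) = Real.tan (Real.pi / 2 - θ / 2) := by
    rw [Real.tan_eq_sin_div_cos, Real.sin_pi_div_two_sub, Real.cos_pi_div_two_sub,
      Real.cot_eq_cos_div_sin]
  rw [cotAngle, mul_div_cancel_left₀ _ hc, h,
    Real.arctan_tan (by linarith [hθ.2]) (by linarith [hθ.1])]
  ring

theorem image_cotAngle (hc : c ≠ 0) : cotAngle c '' Set.univ = Set.Ioo 0 (2 * Real.pi) := by
  ext θ
  constructor
  · rintro ⟨x, -, rfl⟩
    exact cotAngle_mem c x
  · exact fun h => ⟨_, trivial, cotAngle_cot hc h⟩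

theorem injective_cotAngle (hc : c ≠ 0) : Function.Injective (cotAngle c) := fun x y h => by
  rw [← cot_cotAngle hc x, h, cot_cotAngle hc y]

theorem intervalIntegral_eq_integral_cotAngle {E : Type*} [NormedAddCommGroup E] [NormedSpace ℝ E]
    (hc : c ≠ 0) (G : ℝ → E) :
    ∫ θ in (0 : ℝ)..(2 * Real.pi), G θ = ∫ x, |cotJacobian c x|⁻¹ • G (cotAngle c x) := by
  rw [intervalIntegral.integral_of_le Real.two_pi_pos.le, integral_Ioc_eq_integral_Ioo,
    ← image_cotAngle hc, integral_image_eq_integral_abs_deriv_smul MeasurableSet.univ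
      (fun x _ => (hasDerivAt_cotAngle hc x).hasDerivWithinAt) (injective_cotAngle hc).injOn]
  simp [abs_neg, abs_inv]

theorem intervalIntegrable_iff_integrable_cotAngle {E : Type*} [NormedAddCommGroup E]
    [NormedSpace ℝ E] (hc : c ≠ 0) (G : ℝ → E) :
    IntervalIntegrable G volume 0 (2 * Real.pi) ↔
      Integrable fun x => |cotJacobian c x|⁻¹ • G (cotAngle c x) := by
  rw [intervalIntegrable_iff_integrableOn_Ioo_of_le Real.two_pi_pos.le,
    ← image_cotAngle hc, integrableOn_image_iff_integrableOn_abs_deriv_smul MeasurableSet.univ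
      (fun x _ => (hasDerivAt_cotAngle hc x).hasDerivWithinAt) (injective_cotAngle hc).injOn]
  simp [abs_neg, abs_inv]

open Classical in
/-- The `2π`-periodic function `θ ↦ h (c cot(θ/2))`, with value `0` at the poles. -/
noncomputable def cotPullback {E : Type*} [Zero E] (c : ℝ) (h : ℝ → E) (θ : ℝ) : E :=
  if Real.sin (θ / 2) = 0 then 0 else h (c * Real.cot (θ / 2))

theorem sin_half_ne_zero {θ : ℝ} (hθ : θ ∈ Set.Ioo 0 (2 * Real.pi)) : Real.sin (θ / 2) ≠ 0 :=
  (Real.sin_pos_of_pos_of_lt_pi (by linarith [hθ.1]) (by linarith [hθ.2])).ne'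

theorem cotPullback_cotAngle {E : Type*} [Zero E] (hc : c ≠ 0) (h : ℝ → E) (x : ℝ) :
    cotPullback c h (cotAngle c x) = h x := by
  rw [cotPullback, if_neg (sin_half_ne_zero (cotAngle_mem c x)), cot_cotAngle hc]

theorem periodic_cotPullback {E : Type*} [Zero E] (c : ℝ) (h : ℝ → E) :
    Function.Periodic (cotPullback c h) (2 * Real.pi) := fun θ => by
  have : (θ + 2 * Real.pi) / 2 = θ / 2 + Real.pi := by ring
  simp only [cotPullback, this, Real.cot_eq_cos_div_sin, Real.sin_add_pi, Real.cos_add_pi,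
    neg_div_neg_eq, neg_eq_zero]

/-- Near a pole, $c\cot(\theta/2)$ is the reciprocal of a function tending to $0$ through nonzero
values. The filter has the form that limits of `if`-expressions require. -/
theorem tendsto_cot_cocompact (hc : c ≠ 0) {θ₀ : ℝ} (h0 : Real.sin (θ₀ / 2) = 0) :
    Tendsto (fun θ => c * Real.cot (θ / 2)) (𝓝 θ₀ ⊓ 𝓟 {θ | ¬Real.sin (θ / 2) = 0})
      (cocompact ℝ) := by
  have hcos : Real.cos (θ₀ / 2) ≠ 0 := fun h => by
    have := Real.sin_sq_add_cos_sq (θ₀ / 2)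
    rw [h0, h] at this
    norm_num at this
  have hcc : ContinuousAt (fun θ : ℝ => c * Real.cos (θ / 2)) θ₀ := by fun_prop
  have hlim : Tendsto (fun θ : ℝ => Real.sin (θ / 2) / (c * Real.cos (θ / 2))) (𝓝 θ₀) (𝓝 0) := by
    have : ContinuousAt (fun θ : ℝ => Real.sin (θ / 2)) θ₀ := by fun_prop
    have := this.div hcc (mul_ne_zero hc hcos)
    simpa [ContinuousAt, h0, Pi.div_def] using this
  have hev : ∀ᶠ θ in 𝓝 θ₀, c * Real.cos (θ / 2) ≠ 0 := hcc.eventually_ne (mul_ne_zero hc hcos)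
  have h1 : Tendsto (fun θ : ℝ => Real.sin (θ / 2) / (c * Real.cos (θ / 2)))
      (𝓝 θ₀ ⊓ 𝓟 {θ | ¬Real.sin (θ / 2) = 0}) (𝓝[≠] 0) := by
    refine tendsto_nhdsWithin_iff.2 ⟨hlim.mono_left inf_le_left, ?_⟩
    filter_upwards [hev.filter_mono inf_le_left, mem_inf_of_right (mem_principal_self _)]
      with θ h h' using div_ne_zero h' h
  rw [← Metric.cobounded_eq_cocompact]
  refine (tendsto_inv₀_nhdsNE_zero.comp h1).congr fun θ => ?_
  rw [Function.comp_apply, inv_div, Real.cot_eq_cos_div_sin, mul_div_assoc]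

theorem contDiffAt_cot {θ : ℝ} (h : Real.sin (θ / 2) ≠ 0) :
    ContDiffAt ℝ ∞ (fun θ => c * Real.cot (θ / 2)) θ := by
  simp only [Real.cot_eq_cos_div_sin]
  have h1 : ContDiffAt ℝ ∞ (fun θ : ℝ => Real.cos (θ / 2)) θ := by fun_prop
  have h2 : ContDiffAt ℝ ∞ (fun θ : ℝ => Real.sin (θ / 2)) θ := by fun_prop
  exact contDiffAt_const.mul (h1.div h2 h)

theorem cotPullback_eventuallyEq {E : Type*} [Zero E] (h : ℝ → E) {θ : ℝ}
    (hθ : Real.sin (θ / 2) ≠ 0) :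
    cotPullback c h =ᶠ[𝓝 θ] fun θ => h (c * Real.cot (θ / 2)) := by
  have : ContinuousAt (fun θ : ℝ => Real.sin (θ / 2)) θ := by fun_prop
  filter_upwards [this.eventually_ne hθ] with η hη
  rw [cotPullback, if_neg hη]

theorem continuous_cotPullback (hc : c ≠ 0) {h : ℝ → ℂ} (hh : Continuous h)
    (h0 : Tendsto h (cocompact ℝ) (𝓝 0)) : Continuous (cotPullback c h) := by
  refine continuous_iff_continuousAt.2 fun θ => ?_
  by_cases hθ : Real.sin (θ / 2) = 0
  · rw [ContinuousAt, cotPullback, if_pos hθ]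
    exact tendsto_const_nhds.if (h0.comp (tendsto_cot_cocompact hc hθ))
  · refine ContinuousAt.congr ?_ (cotPullback_eventuallyEq h hθ).symm
    exact hh.continuousAt.comp (contDiffAt_cot (c := c) hθ).continuousAt

/-- Near a pole the argument leaves the compact support, so the pullback vanishes there identically.
Compactly supported functions on the line thereby become periodic test functions. -/
theorem contDiff_cotPullback (hc : c ≠ 0) {χ : ℝ → ℝ} (hχ : ContDiff ℝ ∞ χ)
    (hs : HasCompactSupport χ) : ContDiff ℝ ∞ (cotPullback c χ) := by
  refine contDiff_iff_contDiffAt.2 fun θ => ?_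
  by_cases hθ : Real.sin (θ / 2) = 0
  · refine (contDiffAt_const (c := (0 : ℝ))).congr_of_eventuallyEq ?_
    have h1 := (tendsto_cot_cocompact hc hθ).eventually hs.isCompact.compl_mem_cocompact
    rw [eventually_inf_principal] at h1
    filter_upwards [h1] with η hη
    rw [cotPullback]
    split_ifs with h'
    · rfl
    · exact image_eq_zero_of_notMem_tsupport (hη h')
  · exact ContDiffAt.congr_of_eventuallyEq (hχ.contDiffAt.comp θ (contDiffAt_cot (c := c) hθ))
      (cotPullback_eventuallyEq χ hθ)

open Classical in
/-- A function of `x = c cot(θ/2) ∈ ℝ` as a function on the circle, with value `0` at `θ = 0`. -/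
noncomputable def circlePullback (c : ℝ) (h : ℝ → ℂ) (θ : Circ) : ℂ :=
  if θ = 0 then 0 else h (c * Real.cot ((AddCircle.equivIco (2 * Real.pi) 0 θ : ℝ) / 2))

theorem circlePullback_coe (c : ℝ) (h : ℝ → ℂ) (θ : ℝ) :
    circlePullback c h (θ : Circ) = cotPullback c h θ := by
  set t : ℝ := (AddCircle.equivIco (2 * Real.pi) 0 (θ : Circ) : ℝ) with ht
  have hmem : t ∈ Set.Ico 0 (0 + 2 * Real.pi) := (AddCircle.equivIco (2 * Real.pi) 0 (θ : Circ)).2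
  have hcoe : (t : Circ) = θ := AddCircle.coe_equivIco
  obtain ⟨n, hn⟩ := (AddCircle.coe_eq_zero_iff (2 * Real.pi) (x := θ - t)).1 (by
    rw [AddCircle.coe_sub, hcoe, sub_self])
  have hper : cotPullback c h θ = cotPullback c h t := by
    rw [← (periodic_cotPullback c h).zsmul n t, hn, add_sub_cancel]
  rw [hper, circlePullback, cotPullback, ← ht, ← hcoe]
  have : (t : Circ) = 0 ↔ Real.sin (t / 2) = 0 := by
    rw [AddCircle.coe_eq_zero_iff_of_mem_Ico (by simpa using hmem)]
    refine ⟨fun h => by simp [h], fun h => ?_⟩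
    by_contra h'
    exact sin_half_ne_zero ⟨lt_of_le_of_ne hmem.1 (Ne.symm h'), by simpa using hmem.2⟩ h
  simp only [this]

theorem circlePullback_cotAngle (hc : c ≠ 0) (h : ℝ → ℂ) (x : ℝ) :
    circlePullback c h (cotAngle c x : ℝ) = h x := by
  rw [circlePullback_coe, cotPullback_cotAngle hc]

theorem continuous_circlePullback (hc : c ≠ 0) {h : ℝ → ℂ} (hh : Continuous h)
    (h0 : Tendsto h (cocompact ℝ) (𝓝 0)) : Continuous (circlePullback c h) := by
  refine (QuotientAddGroup.isQuotientMap_mk _).continuous_iff.2 ?_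
  refine (continuous_cotPullback hc hh h0).congr fun θ => (circlePullback_coe c h θ).symm

end Substitution

/-! ### Derivatives of the transformed function -/

/-- The coefficients of `(-q d/dx)^τ (a u) = ∑ⱼ pullbackCoeff c a τ j · u^(j)`, where `-q d/dx` is
the derivative with respect to `θ` in the variable `x = c cot(θ/2)`. -/
noncomputable def pullbackCoeff (c : ℝ) (a : ℝ → ℝ) : ℕ → ℕ → ℝ → ℝ
  | 0, 0 => a
  | 0, _ + 1 => fun _ => 0
  | τ + 1, 0 => fun x => -cotJacobian c x * deriv (pullbackCoeff c a τ 0) x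
  | τ + 1, j + 1 => fun x =>
      -cotJacobian c x * (deriv (pullbackCoeff c a τ (j + 1)) x + pullbackCoeff c a τ j x)

/-- The `τ`-th derivative with respect to `θ` of `a u` in the variable `x = c cot(θ/2)`, where `v j`
is the `j`-th derivative of `u`. -/
noncomputable def pullbackDeriv (c : ℝ) (a : ℝ → ℝ) (τ : ℕ) (v : ℕ → ℝ → ℂ) (x : ℝ) : ℂ :=
  ∑ j ∈ Finset.range (τ + 1), pullbackCoeff c a τ j x • v j x

section Coefficients

variable {c : ℝ} {ρ a : ℝ → ℝ}

theorem RapidlyDominated.cotJacobian_mul (ha : RapidlyDominated ρ a) :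
    RapidlyDominated ρ fun x => cotJacobian c x * a x := by
  have h := (ha.const_mul (c ^ 2 / (2 * c))).add (ha.id_mul.id_mul.const_mul (1 / (2 * c)))
  refine (congrArg (RapidlyDominated ρ) (funext fun x => ?_)).mp h
  rw [cotJacobian]
  ring

theorem RapidlyDominated.pullbackCoeff (ha : RapidlyDominated ρ a) (c : ℝ) (τ : ℕ) :
    ∀ j, RapidlyDominated ρ (pullbackCoeff c a τ j) := by
  have aux : ∀ {b : ℝ → ℝ}, RapidlyDominated ρ b →
      RapidlyDominated ρ fun x => -cotJacobian c x * b x := fun hb => by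
    simpa only [neg_mul, one_mul] using (hb.cotJacobian_mul (c := c)).const_mul (-1)
  induction τ with
  | zero =>
    rintro (_ | j)
    · exact ha
    · exact .zero
  | succ τ ih =>
    rintro (_ | j)
    · exact aux (ih 0).deriv
    · exact aux ((ih (j + 1)).deriv.add (ih j))

theorem pullbackCoeff_of_lt (c : ℝ) (a : ℝ → ℝ) {τ : ℕ} : ∀ {j}, τ < j →
    pullbackCoeff c a τ j = fun _ => 0 := by
  induction τ with
  | zero =>
    rintro (_ | j) hj
    · exact absurd hj (lt_irrefl _)
    · rfl
  | succ τ ih =>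
    rintro (_ | j) hj
    · exact absurd hj (Nat.not_lt_zero _)
    · ext x
      rw [pullbackCoeff, ih (Nat.lt_of_succ_lt_succ hj), ih (by omega)]
      simp

theorem pullbackDeriv_zero (c : ℝ) (a : ℝ → ℝ) (v : ℕ → ℝ → ℂ) (x : ℝ) :
    pullbackDeriv c a 0 v x = a x • v 0 x := by
  simp [pullbackDeriv, pullbackCoeff]

theorem pullbackDeriv_succ (c : ℝ) (a : ℝ → ℝ) (τ : ℕ) (v : ℕ → ℝ → ℂ) (x : ℝ) :
    pullbackDeriv c a (τ + 1) v x = -cotJacobian c x • ∑ j ∈ Finset.range (τ + 1),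
      (deriv (pullbackCoeff c a τ j) x • v j x + pullbackCoeff c a τ j x • v (j + 1) x) := by
  -- The recursion involves the derivative of one coefficient beyond the top order, which is zero.
  have h0 : deriv (pullbackCoeff c a τ (τ + 1)) x = 0 := by
    rw [pullbackCoeff_of_lt c a (Nat.lt_succ_self τ)]; simp
  rw [pullbackDeriv, Finset.sum_range_succ', Finset.sum_add_distrib,
    Finset.sum_range_succ' (fun j => deriv (pullbackCoeff c a τ j) x • v j x)]
  simp only [pullbackCoeff, mul_add, add_smul, mul_smul, Finset.sum_add_distrib, ← Finset.smul_sum]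
  rw [Finset.sum_range_succ (fun j => deriv (pullbackCoeff c a τ (j + 1)) x • v (j + 1) x), h0,
    zero_smul, add_zero, smul_add, smul_add]
  abel

/-- Cauchy–Schwarz with $A_{\tau,j}^2\le D_j\rho$ and $|J|^{-1}\le2/|c|$. The constant does not
depend on $v$, so the bound applies to all linear combinations at once. -/
theorem exists_normSq_pullbackDeriv_le (hc : c ≠ 0) (hρ : ∀ x, 0 < ρ x)
    (ha : RapidlyDominated ρ a) (τ : ℕ) : ∃ C, 0 ≤ C ∧ ∀ (v : ℕ → ℝ → ℂ) (x : ℝ),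
      |cotJacobian c x|⁻¹ * ‖pullbackDeriv c a τ v x‖ ^ 2 ≤
        C * ∑ j ∈ Finset.range (τ + 1), ‖v j x‖ ^ 2 * ρ x := by
  have h := fun j => (ha.pullbackCoeff c τ j).2 0 0
  simp only [pow_zero, one_mul, iteratedDeriv_zero] at h
  choose D hD h using h
  have hc' : 0 < |c| := abs_pos.2 hc
  set S := ∑ j ∈ Finset.range (τ + 1), D j with hS
  have hS0 : 0 ≤ S := Finset.sum_nonneg fun j _ => hD j
  refine ⟨2 / |c| * ((τ + 1) * S), by positivity, fun v x => ?_⟩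
  have h1 : ‖pullbackDeriv c a τ v x‖ ^ 2 ≤
      (τ + 1) * ∑ j ∈ Finset.range (τ + 1), S * (‖v j x‖ ^ 2 * ρ x) := by
    calc ‖pullbackDeriv c a τ v x‖ ^ 2
        ≤ (∑ j ∈ Finset.range (τ + 1), ‖pullbackCoeff c a τ j x • v j x‖) ^ 2 := by
          gcongr; exact norm_sum_le _ _
      _ ≤ (Finset.range (τ + 1)).card *
          ∑ j ∈ Finset.range (τ + 1), ‖pullbackCoeff c a τ j x • v j x‖ ^ 2 :=
          sq_sum_le_card_mul_sum_sq
      _ ≤ _ := by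
          rw [Finset.card_range]
          push_cast
          gcongr with j hj
          rw [norm_smul, mul_pow, Real.norm_eq_abs, sq_abs]
          have h2 : D j ≤ S := Finset.single_le_sum (fun i _ => hD i) hj
          have h3 := mul_le_mul_of_nonneg_right
            ((h j x).trans (mul_le_mul_of_nonneg_right h2 (hρ x).le)) (sq_nonneg ‖v j x‖)
          linarith
  have h2 := abs_inv_cotJacobian_le hc x
  rw [abs_inv] at h2
  refine (mul_le_mul h2 h1 (sq_nonneg _) (by positivity)).trans (le_of_eq ?_)
  rw [← Finset.mul_sum]
  ring

end Coefficients

section Transform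

variable {c : ℝ} {ρ a : ℝ → ℝ} {u : ℝ → ℂ} {v : ℕ → ℝ → ℂ} {α : ℕ}

theorem integrable_smul_pullbackDeriv (ha : RapidlyDominated ρ a) {τ : ℕ}
    (hv : ∀ j ≤ τ, AEStronglyMeasurable (v j))
    (hv2 : ∀ j ≤ τ, Integrable fun x => ‖v j x‖ ^ 2 * ρ x) {β : ℝ → ℝ} (hβ : Continuous β) {B : ℝ}
    (hB : ∀ x, |β x| ≤ B) : Integrable fun x => β x • pullbackDeriv c a τ v x := by
  simp only [pullbackDeriv, Finset.smul_sum, ← mul_smul]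
  refine integrable_finsetSum _ fun j hj => ?_
  have hj' := Nat.lt_succ_iff.1 (Finset.mem_range.1 hj)
  exact ((ha.pullbackCoeff c τ j).rootDominated.bdd_mul hβ hB).integrable_smul (hv j hj') (hv2 j hj')

theorem Function.Periodic.exists_abs_le {ψ : ℝ → ℝ} (hψ : Continuous ψ)
    (hp : Function.Periodic ψ (2 * Real.pi)) : ∃ B, ∀ θ, |ψ θ| ≤ B := by
  obtain ⟨B, hB⟩ := hp.isBounded_of_continuous Real.two_pi_pos.ne' hψ |>.exists_norm_le
  exact ⟨B, fun θ => hB _ ⟨θ, rfl⟩⟩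

theorem Function.Periodic.deriv {ψ : ℝ → ℝ} {p : ℝ} (hp : Function.Periodic ψ p) :
    Function.Periodic (deriv ψ) p := fun x => by
  rw [← deriv_comp_add_const, hp.funext]

/-- The density $|J|^{-1}$ cancels the factor $J$ in $-J\,d/dx$ up to the constant sign of $c$; what
remains is a sum of derivatives of products $A_jv_j$. Each is integrated by parts against
$\psi\circ$ `cotAngle`, which is bounded with bounded derivative but not compactly supported. -/
theorem integral_smul_pullbackDeriv_succ (hc : c ≠ 0) (ha : RapidlyDominated ρ a) {τ : ℕ}
    (hv : ∀ j ≤ τ, HasWeakDeriv 1 (v j) (v (j + 1)))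
    (hv2 : ∀ j ≤ τ + 1, Integrable fun x => ‖v j x‖ ^ 2 * ρ x) {ψ : ℝ → ℝ} (hψ : ContDiff ℝ ∞ ψ)
    (hp : Function.Periodic ψ (2 * Real.pi)) :
    ∫ x, |cotJacobian c x|⁻¹ • ψ (cotAngle c x) • pullbackDeriv c a (τ + 1) v x =
      -∫ x, |cotJacobian c x|⁻¹ • deriv ψ (cotAngle c x) • pullbackDeriv c a τ v x := by
  have hψd : ContDiff ℝ ∞ (deriv ψ) := (contDiff_infty_iff_deriv.1 hψ).2
  have hpd : Function.Periodic (deriv ψ) (2 * Real.pi) := hp.deriv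
  obtain ⟨B, hB⟩ := hp.exists_abs_le hψ.continuous
  obtain ⟨B', hB'⟩ := hpd.exists_abs_le hψd.continuous
  have hψc : ContDiff ℝ ∞ fun x => ψ (cotAngle c x) := hψ.comp contDiff_cotAngle
  have hcJ : Continuous fun x => (cotJacobian c x)⁻¹ :=
    contDiff_cotJacobian.continuous.inv₀ (cotJacobian_ne_zero hc)
  let φ : ℝ → ℝ := fun x => -(cotJacobian c x)⁻¹ * deriv ψ (cotAngle c x)
  have hφc : Continuous φ := hcJ.neg.mul (hψd.comp contDiff_cotAngle).continuous
  have hφB : ∀ x, |φ x| ≤ 2 / |c| * B' := fun x => by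
    rw [abs_mul, abs_neg]
    exact mul_le_mul (abs_inv_cotJacobian_le hc x) (hB' _) (abs_nonneg _) (by positivity)
  have hder : ∀ x, HasDerivAt (fun x => ψ (cotAngle c x)) (φ x) x := fun x => by
    have := ((hψ.differentiable (by norm_num)) (cotAngle c x)).hasDerivAt.comp x
      (hasDerivAt_cotAngle hc x)
    rwa [mul_comm] at this
  set s := c / |c| with hs
  have hs1 : s * s = 1 := by
    have : |c| ≠ 0 := abs_ne_zero.2 hc
    rw [hs, div_mul_div_comm, abs_mul_abs_self, div_self (mul_ne_zero hc hc)]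
  have hJ : ∀ x, |cotJacobian c x|⁻¹ = s * (cotJacobian c x)⁻¹ := fun x => by
    rw [abs_cotJacobian, ← hs, mul_inv, inv_eq_of_mul_eq_one_left hs1]
  let A := pullbackCoeff c a τ
  have hA : ∀ j, RapidlyDominated ρ (A j) := ha.pullbackCoeff c τ
  have r0 := fun j => (hA j).rootDominated.bdd_mul hψc.continuous fun x => hB _
  have r1 := fun j => (hA j).deriv.rootDominated.bdd_mul hψc.continuous fun x => hB _
  have r2 := fun j => (hA j).rootDominated.bdd_mul hφc hφB
  have hdA : ∀ j, deriv (fun x => ψ (cotAngle c x) * A j x) =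
      fun x => φ x * A j x + ψ (cotAngle c x) * deriv (A j) x := fun j => funext fun x =>
    ((hder x).mul ((hA j).1.differentiable (by norm_num) x).hasDerivAt).deriv
  have i0 : ∀ j ≤ τ, Integrable fun x => (ψ (cotAngle c x) * A j x) • v (j + 1) x := fun j hj =>
    (r0 j).integrable_smul (hv j hj).2.1.aestronglyMeasurable (hv2 (j + 1) (by omega))
  have i1 : ∀ j ≤ τ, Integrable fun x => (ψ (cotAngle c x) * deriv (A j) x) • v j x := fun j hj =>
    (r1 j).integrable_smul (hv j hj).1.aestronglyMeasurable (hv2 j (by omega))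
  have i2 : ∀ j ≤ τ, Integrable fun x => (φ x * A j x) • v j x := fun j hj =>
    (r2 j).integrable_smul (hv j hj).1.aestronglyMeasurable (hv2 j (by omega))
  have hparts : ∀ j ≤ τ, ∫ x, ((ψ (cotAngle c x) * deriv (A j) x) • v j x +
      (ψ (cotAngle c x) * A j x) • v (j + 1) x) = -∫ x, (φ x * A j x) • v j x := fun j hj => by
    have key := (hv j hj).integral_smul_eq (hv2 j (by omega)) (hv2 (j + 1) (by omega))
      (hψc.mul (hA j).1) (r0 j) (by rw [hdA j]; exact (r2 j).add (r1 j))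
    simp only [hdA j, add_smul] at key
    rw [integral_add (i2 j hj) (i1 j hj)] at key
    rw [integral_add (i1 j hj) (i0 j hj), eq_neg_iff_add_eq_zero, add_right_comm,
      add_comm (∫ x, _ • v j x), key, neg_add_cancel]
  have i01 : ∀ j ≤ τ, Integrable fun x => (ψ (cotAngle c x) * deriv (A j) x) • v j x +
      (ψ (cotAngle c x) * A j x) • v (j + 1) x := fun j hj => (i1 j hj).add (i0 j hj)
  have hmem : ∀ {j}, j ∈ Finset.range (τ + 1) → j ≤ τ := fun hj =>
    Nat.lt_succ_iff.1 (Finset.mem_range.1 hj)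
  calc ∫ x, |cotJacobian c x|⁻¹ • ψ (cotAngle c x) • pullbackDeriv c a (τ + 1) v x
      = ∫ x, -s • ∑ j ∈ Finset.range (τ + 1), ((ψ (cotAngle c x) * deriv (A j) x) • v j x +
          (ψ (cotAngle c x) * A j x) • v (j + 1) x) := by
        refine integral_congr_ae (Eventually.of_forall fun x => ?_)
        have : |cotJacobian c x|⁻¹ * (ψ (cotAngle c x) * -cotJacobian c x) =
            -s * ψ (cotAngle c x) := by
          rw [hJ]; field_simp [cotJacobian_ne_zero hc x]
        simp only [pullbackDeriv_succ, ← mul_smul, this]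
        simp only [mul_smul, Finset.smul_sum, smul_add, A]
    _ = -s • ∑ j ∈ Finset.range (τ + 1), -∫ x, (φ x * A j x) • v j x := by
        rw [integral_smul, integral_finsetSum _ fun j hj => i01 j (hmem hj)]
        exact congrArg _ (Finset.sum_congr rfl fun j hj => hparts j (hmem hj))
    _ = -∫ x, -s • ∑ j ∈ Finset.range (τ + 1), (φ x * A j x) • v j x := by
        rw [integral_smul, integral_finsetSum _ fun j hj => i2 j (hmem hj),
          Finset.sum_neg_distrib, smul_neg]
    _ = _ := by
        congr 1
        refine integral_congr_ae (Eventually.of_forall fun x => ?_)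
        have : |cotJacobian c x|⁻¹ * deriv ψ (cotAngle c x) = -s * φ x := by
          rw [hJ]; simp only [φ]; ring
        simp only [← mul_smul, this, pullbackDeriv]
        simp only [mul_smul, Finset.smul_sum, A]

theorem integral_smul_pullbackDeriv (hc : c ≠ 0) (ha : RapidlyDominated ρ a) {τ : ℕ}
    (hv : ∀ j < τ, HasWeakDeriv 1 (v j) (v (j + 1)))
    (hv2 : ∀ j ≤ τ, Integrable fun x => ‖v j x‖ ^ 2 * ρ x) {ψ : ℝ → ℝ} (hψ : ContDiff ℝ ∞ ψ)
    (hp : Function.Periodic ψ (2 * Real.pi)) :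
    ∫ x, |cotJacobian c x|⁻¹ • ψ (cotAngle c x) • pullbackDeriv c a τ v x =
      (-1) ^ τ * ∫ x, |cotJacobian c x|⁻¹ • iteratedDeriv τ ψ (cotAngle c x) • a x • v 0 x := by
  induction τ generalizing ψ with
  | zero => simp [pullbackDeriv_zero]
  | succ τ ih =>
    rw [integral_smul_pullbackDeriv_succ hc ha (fun j hj => hv j (by omega)) hv2 hψ hp,
      ih (fun j hj => hv j (by omega)) (fun j hj => hv2 j (by omega))
        (contDiff_infty_iff_deriv.1 hψ).2 hp.deriv, iteratedDeriv_succ']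
    ring

end Transform

/-! ### Weak derivatives and membership in the Sobolev spaces -/

theorem HasWeakDeriv.ae_eq {τ : ℕ} {u v v' : ℝ → ℂ} (h : HasWeakDeriv τ u v)
    (h' : HasWeakDeriv τ u v') : v =ᵐ[volume] v' :=
  ae_eq_of_integral_contDiff_smul_eq h.2.1 h'.2.1 fun ψ hψ hc => by
    rw [h.2.2 ψ hψ hc, h'.2.2 ψ hψ hc]

theorem hasWeakDeriv_weakDeriv {τ : ℕ} {u v : ℝ → ℂ} (h : HasWeakDeriv τ u v) :
    HasWeakDeriv τ u (weakDeriv τ u) := by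
  have h' : ∃ v, HasWeakDeriv τ u v := ⟨v, h⟩
  rw [weakDeriv, dif_pos h']
  exact h'.choose_spec

theorem hasWeakDeriv_zero_self {u : ℝ → ℂ} (hu : Continuous u) : HasWeakDeriv 0 u u :=
  ⟨hu.locallyIntegrable, hu.locallyIntegrable, fun ψ _ _ => by simp⟩

theorem hasWeakDeriv_of_mem {α τ : ℕ} {ρ : ℝ → ℝ} {u : ℝ → ℂ} (hu : u ∈ weightedSobolev α ρ)
    (hτ : τ ≤ α) : HasWeakDeriv τ u (weakDeriv τ u) :=
  let ⟨_, hv, _⟩ := hu.2 τ hτ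
  hasWeakDeriv_weakDeriv hv

theorem integrable_normSq_weakDeriv {α τ : ℕ} {ρ : ℝ → ℝ} {u : ℝ → ℂ}
    (hu : u ∈ weightedSobolev α ρ) (hτ : τ ≤ α) :
    Integrable fun x => ‖weakDeriv τ u x‖ ^ 2 * ρ x := by
  obtain ⟨v, hv, hi⟩ := hu.2 τ hτ
  refine hi.congr ?_
  filter_upwards [hv.ae_eq (hasWeakDeriv_weakDeriv hv)] with x hx
  rw [hx]

theorem hasPeriodicWeakDeriv_periodicWeakDeriv {τ : ℕ} {u v : Circ → ℂ}
    (h : HasPeriodicWeakDeriv τ u v) : HasPeriodicWeakDeriv τ u (periodicWeakDeriv τ u) := by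
  have h' : ∃ v, HasPeriodicWeakDeriv τ u v := ⟨v, h⟩
  rw [periodicWeakDeriv, dif_pos h']
  exact h'.choose_spec

/-- Periodic test functions that vanish near $\theta=0$ already determine a weak derivative almost
everywhere, and these are the pullbacks of compactly supported functions on the line. -/
theorem HasPeriodicWeakDeriv.ae_eq_cotAngle {c : ℝ} (hc : c ≠ 0) {τ : ℕ} {u v v' : Circ → ℂ}
    (h : HasPeriodicWeakDeriv τ u v) (h' : HasPeriodicWeakDeriv τ u v') :
    ∀ᵐ x : ℝ, v (cotAngle c x : ℝ) = v' (cotAngle c x : ℝ) := by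
  have hi := (intervalIntegrable_iff_integrable_cotAngle hc _).1 h.2.1
  have hi' := (intervalIntegrable_iff_integrable_cotAngle hc _).1 h'.2.1
  have key := ae_eq_of_integral_contDiff_smul_eq hi.locallyIntegrable hi'.locallyIntegrable
    fun χ hχ hs => by
      have e := (h.2.2 _ (contDiff_cotPullback hc hχ hs) (periodic_cotPullback c χ)).trans
        (h'.2.2 _ (contDiff_cotPullback hc hχ hs) (periodic_cotPullback c χ)).symm
      rw [intervalIntegral_eq_integral_cotAngle hc, intervalIntegral_eq_integral_cotAngle hc] at e
      simpa only [cotPullback_cotAngle hc, smul_comm (|_|⁻¹) (χ _)] using e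
  filter_upwards [key] with x hx
  exact smul_right_injective ℂ (inv_ne_zero (abs_ne_zero.2 (cotJacobian_ne_zero hc x))) hx

/-- The transformation `u ↦ u(c cot(θ/2)) ρ(c cot(θ/2)) c φ'(θ)` in one variable. -/
noncomputable def cotTransform (c : ℝ) (ρ : ℝ → ℝ) (u : ℝ → ℂ) : Circ → ℂ :=
  circlePullback c fun x => (cotJacobian c x * ρ x) • u x

section Membership

variable {c : ℝ} {α τ : ℕ} {ρ : 𝓢(ℝ, ℝ)} {u : ℝ → ℂ}

theorem hasPeriodicWeakDeriv_cotTransform (hc : c ≠ 0) (hρ : IsMonotonicSchwartzWeight ρ)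
    (hu : u ∈ weightedSobolev α ρ) (hτ : τ ≤ α) :
    HasPeriodicWeakDeriv τ (cotTransform c ρ u) (circlePullback c
      (pullbackDeriv c (fun x => cotJacobian c x * ρ x) τ fun j => weakDeriv j u)) := by
  have ha : RapidlyDominated ρ fun x => cotJacobian c x * ρ x :=
    hρ.rapidlyDominated.cotJacobian_mul
  have hD : ∀ j ≤ α, HasWeakDeriv j u (weakDeriv j u) := fun j hj => hasWeakDeriv_of_mem hu hj
  have hI : ∀ j ≤ α, Integrable fun x => ‖weakDeriv j u x‖ ^ 2 * ρ x := fun j hj =>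
    integrable_normSq_weakDeriv hu hj
  -- `weakDeriv 0 u` is a chosen representative and agrees with `u` only almost everywhere.
  have hae : u =ᵐ[volume] weakDeriv 0 u := (hasWeakDeriv_zero_self hu.1).ae_eq (hD 0 (zero_le))
  have hJ : Continuous fun x => |cotJacobian c x|⁻¹ :=
    contDiff_cotJacobian.continuous.abs.inv₀ fun x => abs_ne_zero.2 (cotJacobian_ne_zero hc x)
  have hint : ∀ τ ≤ α, Integrable fun x => |cotJacobian c x|⁻¹ •
      pullbackDeriv c (fun x => cotJacobian c x * ρ x) τ (fun j => weakDeriv j u) x :=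
    fun τ hτ => integrable_smul_pullbackDeriv ha
      (fun j hj => (hD j (hj.trans hτ)).2.1.aestronglyMeasurable) (fun j hj => hI j (hj.trans hτ)) hJ
      (fun x => by rw [← abs_inv, abs_abs]; exact abs_inv_cotJacobian_le hc x)
  refine ⟨?_, ?_, fun ψ hψ hp => ?_⟩
  · rw [intervalIntegrable_iff_integrable_cotAngle hc]
    refine (hint 0 (zero_le)).congr ?_
    filter_upwards [hae] with x hx
    rw [cotTransform, circlePullback_cotAngle hc, pullbackDeriv_zero, hx]
  · rw [intervalIntegrable_iff_integrable_cotAngle hc]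
    simpa only [circlePullback_cotAngle hc] using hint τ hτ
  · rw [intervalIntegral_eq_integral_cotAngle hc, intervalIntegral_eq_integral_cotAngle hc]
    simp only [cotTransform, circlePullback_cotAngle hc]
    rw [integral_smul_pullbackDeriv hc ha
      (fun j hj => (hD j (by omega)).succ (hD (j + 1) (by omega)))
      (fun j hj => hI j (hj.trans hτ)) hψ hp]
    congr 1
    refine integral_congr_ae ?_
    filter_upwards [hae] with x hx
    rw [hx]

theorem aestronglyMeasurable_pullbackDeriv (hρ : IsMonotonicSchwartzWeight ρ)
    (hu : u ∈ weightedSobolev α ρ) (hτ : τ ≤ α) : AEStronglyMeasurable (pullbackDeriv c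
      (fun x => cotJacobian c x * ρ x) τ fun j => weakDeriv j u) := by
  refine Finset.aestronglyMeasurable_fun_sum _ fun j hj => ?_
  exact (hρ.rapidlyDominated.cotJacobian_mul.pullbackCoeff c τ
    j).1.continuous.aestronglyMeasurable.smul (hasWeakDeriv_of_mem hu
      ((Nat.lt_succ_iff.1 (Finset.mem_range.1 hj)).trans hτ)).2.1.aestronglyMeasurable

theorem integrable_normSq_pullbackDeriv (hc : c ≠ 0) (hρ : IsMonotonicSchwartzWeight ρ)
    (hu : u ∈ weightedSobolev α ρ) (hτ : τ ≤ α) :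
    Integrable fun x => |cotJacobian c x|⁻¹ * ‖pullbackDeriv c (fun x => cotJacobian c x * ρ x) τ
      (fun j => weakDeriv j u) x‖ ^ 2 := by
  have ha : RapidlyDominated ρ fun x => cotJacobian c x * ρ x :=
    hρ.rapidlyDominated.cotJacobian_mul
  obtain ⟨C, -, hC⟩ := exists_normSq_pullbackDeriv_le hc hρ.1 ha τ
  have hI : ∀ j ∈ Finset.range (τ + 1), Integrable fun x => ‖weakDeriv j u x‖ ^ 2 * ρ x :=
    fun j hj => integrable_normSq_weakDeriv hu
      ((Nat.lt_succ_iff.1 (Finset.mem_range.1 hj)).trans hτ)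
  have hJ : Continuous fun x => |cotJacobian c x|⁻¹ :=
    contDiff_cotJacobian.continuous.abs.inv₀ fun x => abs_ne_zero.2 (cotJacobian_ne_zero hc x)
  have hm := aestronglyMeasurable_pullbackDeriv (c := c) hρ hu hτ
  refine Integrable.mono' ((integrable_finsetSum _ hI).const_mul C)
    (hJ.aestronglyMeasurable.mul (hm.norm.pow 2)) (Eventually.of_forall fun x => ?_)
  rw [Real.norm_of_nonneg (by positivity)]
  exact hC _ x

theorem cotTransform_mem_periodicSobolev (hc : c ≠ 0) (hρ : IsMonotonicSchwartzWeight ρ)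
    (hα : 1 ≤ α) (hu : u ∈ weightedSobolev α ρ) : cotTransform c ρ u ∈ periodicSobolev α := by
  have ha : RapidlyDominated ρ fun x => cotJacobian c x * ρ x :=
    hρ.rapidlyDominated.cotJacobian_mul
  refine ⟨?_, fun τ hτ => ⟨_, hasPeriodicWeakDeriv_cotTransform hc hρ hu hτ, ?_⟩⟩
  · have hI0 : Integrable fun x => ‖u x‖ ^ 2 * ρ x := by
      refine (integrable_normSq_weakDeriv hu (zero_le)).congr ?_
      filter_upwards [(hasWeakDeriv_zero_self hu.1).ae_eq (hasWeakDeriv_of_mem hu (zero_le))]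
        with x hx
      rw [hx]
    -- Decay at infinity, hence continuity at $\theta=0$, uses a first weak derivative; this is
    -- where $\alpha\ge1$ enters.
    have h1 := hasWeakDeriv_of_mem hu hα
    have hI1 := integrable_normSq_weakDeriv hu hα
    refine continuous_circlePullback hc (ha.1.continuous.smul hu.1) ?_
    rw [cocompact_eq_atBot_atTop]
    exact (h1.tendsto_smul_atBot hu.1 hI0 hI1 ha).sup (h1.tendsto_smul_atTop hu.1 hI0 hI1 ha)
  · rw [intervalIntegrable_iff_integrable_cotAngle hc]
    simpa only [circlePullback_cotAngle hc, smul_eq_mul] using integrable_normSq_pullbackDeriv hc hρ hu hτ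

theorem periodicWeakDeriv_cotTransform_ae_eq (hc : c ≠ 0) (hρ : IsMonotonicSchwartzWeight ρ)
    (hu : u ∈ weightedSobolev α ρ) (hτ : τ ≤ α) :
    ∀ᵐ x : ℝ, periodicWeakDeriv τ (cotTransform c ρ u) (cotAngle c x : ℝ) =
      pullbackDeriv c (fun x => cotJacobian c x * ρ x) τ (fun j => weakDeriv j u) x := by
  have h := hasPeriodicWeakDeriv_cotTransform hc hρ hu hτ
  filter_upwards [(hasPeriodicWeakDeriv_periodicWeakDeriv h).ae_eq_cotAngle hc h] with x hx
  rw [hx, circlePullback_cotAngle hc]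

end Membership

/-! ### Gram matrices -/

section Gram

open Matrix
open scoped ComplexOrder

variable {ι X : Type*} [MeasurableSpace X] {μ : Measure X}

theorem integrable_conj_mul {f g : X → ℂ} (hf : MemLp f 2 μ) (hg : MemLp g 2 μ) :
    Integrable (fun x => conj (f x) * g x) μ :=
  hf.star.integrable_mul hg

theorem isHermitian_of_integral {n : ℕ} (h : ℕ → ι → X → ℂ) :
    (Matrix.of fun i j => ∑ τ ∈ Finset.range n, ∫ x, conj (h τ i x) * h τ j x ∂μ).IsHermitian := by
  ext i j
  simp only [conjTranspose_apply, of_apply, star_sum]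
  refine Finset.sum_congr rfl fun τ _ => ?_
  rw [← starRingEnd_apply, ← integral_conj]
  simp [mul_comm]

variable [Fintype ι]

theorem star_dotProduct_of_integral {n : ℕ} {h : ℕ → ι → X → ℂ}
    (hh : ∀ τ < n, ∀ i, MemLp (h τ i) 2 μ) (a : ι → ℂ) :
    star a ⬝ᵥ ((Matrix.of fun i j => ∑ τ ∈ Finset.range n, ∫ x, conj (h τ i x) * h τ j x ∂μ) *ᵥ a) =
      ((∑ τ ∈ Finset.range n, ∫ x, ‖∑ i, a i * h τ i x‖ ^ 2 ∂μ : ℝ) : ℂ) := by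
  have key : ∀ τ < n, ((∫ x, ‖∑ i, a i * h τ i x‖ ^ 2 ∂μ : ℝ) : ℂ) =
      ∑ i, ∑ j, conj (a i) * (∫ x, conj (h τ i x) * h τ j x ∂μ) * a j := fun τ hτ => by
    rw [← integral_complex_ofReal]
    have : ∀ x, ((‖∑ i, a i * h τ i x‖ ^ 2 : ℝ) : ℂ) =
        ∑ i, ∑ j, conj (a i) * (conj (h τ i x) * h τ j x) * a j := fun x => by
      push_cast
      rw [← Complex.conj_mul', map_sum, Finset.sum_mul_sum]
      simp only [map_mul]
      refine Finset.sum_congr rfl fun i _ => Finset.sum_congr rfl fun j _ => by ring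
    simp_rw [this]
    have hi : ∀ i j, Integrable (fun x => conj (a i) * (conj (h τ i x) * h τ j x) * a j) μ :=
      fun i j => ((integrable_conj_mul (hh τ hτ i) (hh τ hτ j)).const_mul _).mul_const _
    rw [integral_finsetSum _ fun i _ => integrable_finsetSum _ fun j _ => hi i j]
    refine Finset.sum_congr rfl fun i _ => ?_
    rw [integral_finsetSum _ fun j _ => hi i j]
    refine Finset.sum_congr rfl fun j _ => ?_
    rw [integral_mul_const, integral_const_mul]
  push_cast
  rw [Finset.sum_congr rfl fun τ hτ => key τ (Finset.mem_range.1 hτ)]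
  simp only [dotProduct, mulVec, of_apply, Finset.mul_sum, Finset.sum_mul, Pi.star_apply,
    RCLike.star_def]
  conv_rhs => rw [Finset.sum_comm]
  refine Finset.sum_congr rfl fun i _ => ?_
  conv_rhs => rw [Finset.sum_comm]
  simp only [mul_assoc]

theorem posSemidef_of_integral {n : ℕ} {h : ℕ → ι → X → ℂ}
    (hh : ∀ τ < n, ∀ i, MemLp (h τ i) 2 μ) :
    (Matrix.of fun i j => ∑ τ ∈ Finset.range n, ∫ x, conj (h τ i x) * h τ j x ∂μ).PosSemidef := by
  refine posSemidef_iff_dotProduct_mulVec.2 ⟨isHermitian_of_integral h, fun a => ?_⟩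
  rw [star_dotProduct_of_integral hh]
  exact_mod_cast Finset.sum_nonneg fun τ _ => integral_nonneg fun x => sq_nonneg _

/-- The quadratic form of a Gram matrix is the squared norm of a linear combination, so a norm bound
on all combinations is a Loewner inequality. In this form it survives entrywise products. -/
theorem posSemidef_smul_sub_of_integral {n : ℕ} {h h' : ℕ → ι → X → ℂ}
    (hh : ∀ τ < n, ∀ i, MemLp (h τ i) 2 μ) (hh' : ∀ τ < n, ∀ i, MemLp (h' τ i) 2 μ) {C : ℝ}
    (hC : ∀ a : ι → ℂ, ∑ τ ∈ Finset.range n, ∫ x, ‖∑ i, a i * h' τ i x‖ ^ 2 ∂μ ≤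
      C * ∑ τ ∈ Finset.range n, ∫ x, ‖∑ i, a i * h τ i x‖ ^ 2 ∂μ) :
    ((C : ℂ) • (Matrix.of fun i j => ∑ τ ∈ Finset.range n, ∫ x, conj (h τ i x) * h τ j x ∂μ) -
      Matrix.of fun i j => ∑ τ ∈ Finset.range n, ∫ x, conj (h' τ i x) * h' τ j x ∂μ).PosSemidef := by
  refine posSemidef_iff_dotProduct_mulVec.2 ⟨?_, fun a => ?_⟩
  · refine IsHermitian.sub ?_ (isHermitian_of_integral h')
    rw [IsHermitian, conjTranspose_smul, (isHermitian_of_integral h).eq]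
    simp
  · rw [sub_mulVec, dotProduct_sub, smul_mulVec, dotProduct_smul, star_dotProduct_of_integral hh,
      star_dotProduct_of_integral hh', smul_eq_mul, ← Complex.ofReal_mul, ← Complex.ofReal_sub]
    exact_mod_cast sub_nonneg.2 (hC a)

end Gram

/-! ### Boundedness of the transformation in one variable -/

section Bound

open Matrix
open scoped ComplexOrder

variable {c : ℝ} {α : ℕ} {ρ : 𝓢(ℝ, ℝ)}

/-- Derivatives on the line, normalised such that the inner products are those of `L²(ℝ)`. -/
noncomputable def lineFeature (ρ : ℝ → ℝ) (u : ℝ → ℂ) (τ : ℕ) (x : ℝ) : ℂ :=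
  √(ρ x) • weakDeriv τ u x

/-- Derivatives on the circle, normalised such that the inner products are those of `L²(ℝ)` in the
variable `x = c cot(θ/2)`. -/
noncomputable def circleFeature (c : ℝ) (w : Circ → ℂ) (τ : ℕ) (x : ℝ) : ℂ :=
  √(|cotJacobian c x|⁻¹) • periodicWeakDeriv τ w (cotAngle c x : ℝ)

theorem conj_sqrt_smul_mul {r : ℝ} (hr : 0 ≤ r) (z w : ℂ) :
    conj (√r • z) * (√r • w) = conj z * w * (r : ℂ) := by
  rw [Complex.real_smul, Complex.real_smul, map_mul, Complex.conj_ofReal, mul_mul_mul_comm,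
    ← Complex.ofReal_mul, Real.mul_self_sqrt hr, mul_comm]

theorem weightedSobolevInner_eq {ρ : ℝ → ℝ} (hρ : ∀ x, 0 < ρ x) (u w : ℝ → ℂ) :
    weightedSobolevInner α ρ u w =
      ∑ τ ∈ Finset.range (α + 1), ∫ x, conj (lineFeature ρ u τ x) * lineFeature ρ w τ x := by
  simp only [weightedSobolevInner, lineFeature, conj_sqrt_smul_mul (hρ _).le]

theorem periodicSobolevInner_eq (hc : c ≠ 0) (u w : Circ → ℂ) :
    periodicSobolevInner α u w =
      ∑ τ ∈ Finset.range (α + 1), ∫ x, conj (circleFeature c u τ x) * circleFeature c w τ x := by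
  refine Finset.sum_congr rfl fun τ _ => ?_
  rw [intervalIntegral_eq_integral_cotAngle hc]
  simp only [circleFeature]
  refine integral_congr_ae (Eventually.of_forall fun x => ?_)
  simp only
  rw [conj_sqrt_smul_mul (by positivity), Complex.real_smul, mul_comm]

theorem memLp_lineFeature {ρ : ℝ → ℝ} (hρc : Continuous ρ) (hρ : ∀ x, 0 < ρ x) {u : ℝ → ℂ}
    (hu : u ∈ weightedSobolev α ρ) {τ : ℕ} (hτ : τ ≤ α) : MemLp (lineFeature ρ u τ) 2 := by
  have hm : AEStronglyMeasurable (lineFeature ρ u τ) :=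
    hρc.sqrt.aestronglyMeasurable.smul (hasWeakDeriv_of_mem hu hτ).2.1.aestronglyMeasurable
  rw [memLp_two_iff_integrable_sq_norm hm]
  refine (integrable_normSq_weakDeriv hu hτ).congr (Eventually.of_forall fun x => ?_)
  simp only [lineFeature]
  rw [norm_smul, mul_pow, Real.norm_eq_abs, sq_abs, Real.sq_sqrt (hρ x).le, mul_comm]

theorem circleFeature_cotTransform_ae_eq (hc : c ≠ 0) (hρ : IsMonotonicSchwartzWeight ρ)
    {u : ℝ → ℂ} (hu : u ∈ weightedSobolev α ρ) {τ : ℕ} (hτ : τ ≤ α) :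
    circleFeature c (cotTransform c ρ u) τ =ᵐ[volume] fun x => √(|cotJacobian c x|⁻¹) •
      pullbackDeriv c (fun x => cotJacobian c x * ρ x) τ (fun j => weakDeriv j u) x := by
  filter_upwards [periodicWeakDeriv_cotTransform_ae_eq hc hρ hu hτ] with x hx
  rw [circleFeature, hx]

theorem normSq_sqrt_inv_smul (c x : ℝ) (z : ℂ) :
    ‖√(|cotJacobian c x|⁻¹) • z‖ ^ 2 = |cotJacobian c x|⁻¹ * ‖z‖ ^ 2 := by
  rw [norm_smul, mul_pow, Real.norm_eq_abs, sq_abs, Real.sq_sqrt (by positivity)]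

theorem memLp_circleFeature (hc : c ≠ 0) (hρ : IsMonotonicSchwartzWeight ρ)
    {u : ℝ → ℂ} (hu : u ∈ weightedSobolev α ρ) {τ : ℕ} (hτ : τ ≤ α) :
    MemLp (circleFeature c (cotTransform c ρ u) τ) 2 := by
  refine (memLp_congr_ae (circleFeature_cotTransform_ae_eq hc hρ hu hτ)).2 ?_
  have hJ : Continuous fun x => |cotJacobian c x|⁻¹ :=
    contDiff_cotJacobian.continuous.abs.inv₀ fun x => abs_ne_zero.2 (cotJacobian_ne_zero hc x)
  refine (memLp_two_iff_integrable_sq_norm (hJ.sqrt.aestronglyMeasurable.smul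
    (aestronglyMeasurable_pullbackDeriv hρ hu hτ))).2 ?_
  simpa only [Pi.smul_apply', normSq_sqrt_inv_smul] using integrable_normSq_pullbackDeriv hc hρ hu hτ

theorem exists_sum_integral_circleFeature_le (hc : c ≠ 0) (hρ : IsMonotonicSchwartzWeight ρ)
    (α : ℕ) : ∃ C : ℝ, 0 ≤ C ∧ ∀ (ι : Type) [Fintype ι] (u : ι → ℝ → ℂ),
      (∀ i, u i ∈ weightedSobolev α ρ) → ∀ a : ι → ℂ,
      ∑ τ ∈ Finset.range (α + 1),
        ∫ x, ‖∑ i, a i * circleFeature c (cotTransform c ρ (u i)) τ x‖ ^ 2 ≤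
      C * ∑ τ ∈ Finset.range (α + 1), ∫ x, ‖∑ i, a i * lineFeature ρ (u i) τ x‖ ^ 2 := by
  choose D hD h using exists_normSq_pullbackDeriv_le hc hρ.1
    (hρ.rapidlyDominated.cotJacobian_mul (c := c))
  refine ⟨∑ τ ∈ Finset.range (α + 1), D τ, Finset.sum_nonneg fun τ _ => hD τ,
    fun ι _ u hu a => ?_⟩
  rw [Finset.sum_mul]
  refine Finset.sum_le_sum fun τ hτ => ?_
  have hτ' : τ ≤ α := Nat.lt_succ_iff.1 (Finset.mem_range.1 hτ)
  have hi : ∀ j ∈ Finset.range (α + 1),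
      Integrable fun x => ‖∑ i, a i * lineFeature ρ (u i) j x‖ ^ 2 := fun j hj => by
    have : MemLp (fun x => ∑ i, a i * lineFeature ρ (u i) j x) 2 :=
      memLp_finsetSum _ fun i _ => (memLp_lineFeature (ρ.continuous) hρ.1 (hu i)
        (Nat.lt_succ_iff.1 (Finset.mem_range.1 hj))).const_mul (a i)
    exact this.integrable_norm_pow (by norm_num)
  have hle : ∀ᵐ x : ℝ, ‖∑ i, a i * circleFeature c (cotTransform c ρ (u i)) τ x‖ ^ 2 ≤
      D τ * ∑ j ∈ Finset.range (α + 1), ‖∑ i, a i * lineFeature ρ (u i) j x‖ ^ 2 := by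
    filter_upwards [ae_all_iff.2 fun i => circleFeature_cotTransform_ae_eq hc hρ (hu i) hτ'] with x hx
    -- The chosen weak derivatives need not be additive pointwise, but the explicit formula, valid
    -- almost everywhere, is linear in the derivatives. The bound can thus be applied to
    -- $\sum_ia_iu_i^{(j)}$.
    have h1 : ∑ i, a i * circleFeature c (cotTransform c ρ (u i)) τ x =
        √(|cotJacobian c x|⁻¹) • pullbackDeriv c (fun x => cotJacobian c x * ρ x) τ
          (fun j y => ∑ i, a i * weakDeriv j (u i) y) x := by
      simp only [hx, pullbackDeriv, Finset.smul_sum, Finset.mul_sum, mul_smul_comm]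
      exact Finset.sum_comm
    have h2 : ∀ j, ‖∑ i, a i * weakDeriv j (u i) x‖ ^ 2 * ρ x =
        ‖∑ i, a i * lineFeature ρ (u i) j x‖ ^ 2 := fun j => by
      simp only [lineFeature, mul_smul_comm, ← Finset.smul_sum]
      rw [norm_smul, mul_pow, Real.norm_eq_abs, sq_abs, Real.sq_sqrt (hρ.1 x).le, mul_comm]
    rw [h1, normSq_sqrt_inv_smul]
    refine (h τ _ x).trans (mul_le_mul_of_nonneg_left ?_ (hD τ))
    simp only [h2]
    exact Finset.sum_le_sum_of_subset_of_nonneg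
      (Finset.range_subset_range.2 (by omega)) fun _ _ _ => sq_nonneg _
  rw [← integral_finsetSum _ hi, ← integral_const_mul]
  exact integral_mono_of_nonneg (Eventually.of_forall fun x => sq_nonneg _)
    ((integrable_finsetSum _ hi).const_mul _) hle

theorem exists_posSemidef_sub (hc : c ≠ 0) (hρ : IsMonotonicSchwartzWeight ρ) (α : ℕ) :
    ∃ C : ℝ, 0 ≤ C ∧ ∀ (ι : Type) [Fintype ι] (u : ι → ℝ → ℂ),
      (∀ i, u i ∈ weightedSobolev α ρ) →
      (Matrix.of fun i j => periodicSobolevInner α (cotTransform c ρ (u i))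
        (cotTransform c ρ (u j))).PosSemidef ∧
      ((C : ℂ) • (Matrix.of fun i j => weightedSobolevInner α ρ (u i) (u j)) -
        Matrix.of fun i j => periodicSobolevInner α (cotTransform c ρ (u i))
          (cotTransform c ρ (u j))).PosSemidef := by
  obtain ⟨C, hC, h⟩ := exists_sum_integral_circleFeature_le hc hρ α
  refine ⟨C, hC, fun ι _ u hu => ?_⟩
  simp only [periodicSobolevInner_eq hc, weightedSobolevInner_eq hρ.1]
  have h1 : ∀ τ < α + 1, ∀ i, MemLp (circleFeature c (cotTransform c ρ (u i)) τ) 2 :=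
    fun τ hτ i => memLp_circleFeature hc hρ (hu i) (Nat.lt_succ_iff.1 hτ)
  have h2 : ∀ τ < α + 1, ∀ i, MemLp (lineFeature ρ (u i) τ) 2 :=
    fun τ hτ i => memLp_lineFeature ρ.continuous hρ.1 (hu i) (Nat.lt_succ_iff.1 hτ)
  exact ⟨posSemidef_of_integral (h := fun τ i => circleFeature c (cotTransform c ρ (u i)) τ) h1,
    posSemidef_smul_sub_of_integral (h := fun τ i => lineFeature ρ (u i) τ)
      (h' := fun τ i => circleFeature c (cotTransform c ρ (u i)) τ) h2 h1 (h ι u hu)⟩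

/-! ### Tensor products -/

/-- Induction with the Schur product theorem and the telescoping identity $A\odot P-A'\odot
P'=(A-A')\odot P+A'\odot(P-P')$. -/
theorem posSemidef_prod_sub_prod {ι κ : Type*} [Fintype ι] (A A' : κ → Matrix ι ι ℂ)
    (hA' : ∀ k, (A' k).PosSemidef) (hA : ∀ k, (A k - A' k).PosSemidef) (s : Finset κ) :
    (Matrix.of fun i j => ∏ k ∈ s, A k i j).PosSemidef ∧
    (Matrix.of fun i j => ∏ k ∈ s, A' k i j).PosSemidef ∧
    ((Matrix.of fun i j => ∏ k ∈ s, A k i j) -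
      Matrix.of fun i j => ∏ k ∈ s, A' k i j).PosSemidef := by
  classical
  induction s using Finset.induction_on with
  | empty =>
    have : (Matrix.of fun _ _ : ι => (1 : ℂ)).PosSemidef := by
      have := posSemidef_vecMulVec_self_star (fun _ : ι => (1 : ℂ))
      convert this using 1
      ext i j
      simp [vecMulVec]
    simpa [PosSemidef.zero] using this
  | insert k s hk ih =>
    obtain ⟨h1, h2, h3⟩ := ih
    have e : ∀ B : κ → Matrix ι ι ℂ, (Matrix.of fun i j => ∏ l ∈ insert k s, B l i j) =
        B k ⊙ Matrix.of fun i j => ∏ l ∈ s, B l i j := fun B => by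
      ext i j
      simp [Finset.prod_insert hk]
    have hAk : (A k).PosSemidef := by simpa using (hA k).add (hA' k)
    rw [e, e]
    refine ⟨hAk.hadamard h1, (hA' k).hadamard h2, ?_⟩
    refine (congrArg PosSemidef ?_).mp (((hA k).hadamard h1).add ((hA' k).hadamard h3))
    ext i j
    simp only [Matrix.sub_apply, Matrix.add_apply, hadamard_apply, of_apply]
    ring

theorem FormalTensor.inner_eq_dotProduct {X : Type*} {d : ℕ} (B : Fin d → (X → ℂ) → (X → ℂ) → ℂ)
    (H : FormalTensor X d) :
    FormalTensor.inner B H H = star (fun u : H.support => H u) ⬝ᵥ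
      ((Matrix.of fun u w : H.support => ∏ k, B k (u.1 k) (w.1 k)) *ᵥ fun u : H.support => H u) := by
  simp only [FormalTensor.inner, Finsupp.sum, dotProduct, mulVec, of_apply, Finset.mul_sum,
    Pi.star_apply, RCLike.star_def]
  rw [← Finset.sum_coe_sort H.support]
  refine Finset.sum_congr rfl fun u _ => ?_
  rw [← Finset.sum_coe_sort H.support]
  refine Finset.sum_congr rfl fun w _ => ?_
  ring

/-- The squared norm of a formal tensor is the quadratic form of the entrywise product over $k$ of
the Gram matrices of its $k$-th factors. Indexing by the support allows repeated or dependent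
factors, and the constant is $\prod_kC_k$. -/
theorem exists_inner_mapDomain_le {d : ℕ} {c : Fin d → ℝ} (hc : ∀ k, c k ≠ 0)
    {ρ : Fin d → 𝓢(ℝ, ℝ)} (hρ : ∀ k, IsMonotonicSchwartzWeight (ρ k)) (α : ℕ) :
    ∃ K : ℝ, 0 ≤ K ∧ ∀ H : FormalTensor ℝ d,
      (∀ u ∈ H.support, ∀ k, u k ∈ weightedSobolev α (ρ k)) →
      (FormalTensor.inner (fun k u w => periodicSobolevInner α (cotTransform (c k) (ρ k) u)
        (cotTransform (c k) (ρ k) w)) H H).re ≤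
      K * (FormalTensor.inner (fun k => weightedSobolevInner α (ρ k)) H H).re := by
  choose C hC h using fun k => exists_posSemidef_sub (hc k) (hρ k) α
  refine ⟨∏ k, C k, Finset.prod_nonneg fun k _ => hC k, fun H hH => ?_⟩
  have key := (posSemidef_prod_sub_prod _ _
    (fun k => (h k H.support (fun u => u.1 k) fun u => hH u.1 u.2 k).1)
    (fun k => (h k H.support (fun u => u.1 k) fun u => hH u.1 u.2 k).2) Finset.univ).2.2
  have h0 := key.dotProduct_mulVec_nonneg (fun u : H.support => H u)
  rw [FormalTensor.inner_eq_dotProduct, FormalTensor.inner_eq_dotProduct, ← sub_nonneg]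
  have e : (Matrix.of fun i j : H.support => ∏ k, ((C k : ℂ) •
      (Matrix.of fun u w : H.support => weightedSobolevInner α (ρ k) (u.1 k) (w.1 k))) i j) =
      ((∏ k, C k : ℝ) : ℂ) •
        Matrix.of fun u w : H.support => ∏ k, weightedSobolevInner α (ρ k) (u.1 k) (w.1 k) := by
    ext i j
    simp [Finset.prod_mul_distrib]
  rw [e, sub_mulVec, dotProduct_sub, smul_mulVec, dotProduct_smul, smul_eq_mul] at h0
  have := (Complex.le_def.1 h0).1
  rwa [Complex.sub_re, Complex.re_ofReal_mul] at this

end Bound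

/-! ### Transport of formal tensors and conclusion -/

theorem cotJacobian_cot {c θ : ℝ} (hc : c ≠ 0) (hθ : Real.sin (θ / 2) ≠ 0) :
    cotJacobian c (c * Real.cot (θ / 2)) = c * deriv mobius θ := by
  have hd : HasDerivAt mobius (1 / (2 * Real.sin (θ / 2) ^ 2)) θ := by
    have h2 : HasDerivAt (fun θ : ℝ => θ / 2) (1 / 2) θ := (hasDerivAt_id θ).div_const 2
    have := (h2.cos.div h2.sin hθ).neg
    refine (this.congr_deriv ?_).congr_of_eventuallyEq (Eventually.of_forall fun η => ?_)
    · have := Real.sin_sq_add_cos_sq (θ / 2)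
      field_simp
      linarith
    · simp [mobius, Real.cot_eq_cos_div_sin]
  rw [hd.deriv, cotJacobian, Real.cot_eq_cos_div_sin]
  have := Real.sin_sq_add_cos_sq (θ / 2)
  field_simp
  linarith

theorem FormalTensor.eval_mapDomain {X Y : Type*} {d : ℕ} (T : Fin d → (X → ℂ) → Y → ℂ)
    (F : FormalTensor X d) (y : Fin d → Y) :
    FormalTensor.eval (F.mapDomain fun u k => T k (u k)) y =
      F.sum fun u a => a * ∏ k, T k (u k) (y k) :=
  Finsupp.sum_mapDomain_index (fun _ => zero_mul _) fun _ _ _ => add_mul _ _ _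

/-- Distinct tuples may have the same image under $T$; since the form is additive in each
coefficient, merging them does not change the sum. -/
theorem FormalTensor.inner_mapDomain {X Y : Type*} {d : ℕ} (T : Fin d → (X → ℂ) → Y → ℂ)
    (B : Fin d → (Y → ℂ) → (Y → ℂ) → ℂ) (F : FormalTensor X d) :
    FormalTensor.inner B (F.mapDomain fun u k => T k (u k)) (F.mapDomain fun u k => T k (u k)) =
      FormalTensor.inner (fun k u w => B k (T k u) (T k w)) F F := by
  unfold FormalTensor.inner
  rw [Finsupp.sum_mapDomain_index]
  · refine Finsupp.sum_congr fun u _ => ?_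
    exact Finsupp.sum_mapDomain_index (by simp) (by intros; ring)
  · simp
  · intro u a b
    simp only [map_add, add_mul, Finsupp.sum_add]

theorem mainTheorem10 (d α : ℕ) (hα : 1 ≤ α) (c : Fin d → ℝ) (hc : ∀ k, c k ≠ 0)
    (ρ : Fin d → 𝓢(ℝ, ℝ)) (hρ : ∀ k, IsMonotonicSchwartzWeight (ρ k))
    (f : (Fin d → ℝ) → ℂ) (hf : f ∈ weightedSobolevTensor α (fun k => ρ k)) :
    toTorus (transformedIntegrand c (fun k => ρ k) f) ∈ periodicSobolevTensor d α := by
  classical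
  obtain ⟨F, hFW, hFC, hFlim⟩ := hf
  obtain ⟨K, hK, hle⟩ := exists_inner_mapDomain_le hc hρ α
  let T : Fin d → (ℝ → ℂ) → Circ → ℂ := fun k => cotTransform (c k) (ρ k)
  refine ⟨fun n => (F n).mapDomain fun u k => T k (u k), fun n w hw k => ?_, fun ε hε => ?_,
    fun θ => ?_⟩
  · obtain ⟨u, hu, rfl⟩ := Finset.mem_image.1 (Finsupp.mapDomain_support hw)
    exact cotTransform_mem_periodicSobolev (hc k) (hρ k) hα (hFW n u hu k)
  · have hK1 : 0 < K + 1 := by linarith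
    -- `K + 1` replaces `K` to avoid dividing by zero.
    obtain ⟨N, hN⟩ := hFC (ε / √(K + 1)) (by positivity)
    refine ⟨N, fun m hm n hn => ?_⟩
    have hsub : (F m).mapDomain (fun u k => T k (u k)) - (F n).mapDomain (fun u k => T k (u k)) =
        (F m - F n).mapDomain (fun u k => T k (u k)) :=
      (map_sub (Finsupp.mapDomain.addMonoidHom (M := ℂ) fun (u : Fin d → ℝ → ℂ) k => T k (u k))
        (F m) (F n)).symm
    rw [hsub, FormalTensor.inner_mapDomain]
    have h1 := hN m hm n hn
    rw [div_pow, Real.sq_sqrt hK1.le, lt_div_iff₀ hK1] at h1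
    have h2 := hle (F m - F n) fun u hu k =>
      (Finset.mem_union.1 (Finsupp.support_sub hu)).elim (fun h => hFW m u h k)
        fun h => hFW n u h k
    refine h2.trans_lt ?_
    -- The case split makes a proof that the form is nonnegative unnecessary: a negative value gives
    -- an upper bound at most $0<\varepsilon^2$.
    rcases le_or_gt 0 (FormalTensor.inner (fun k => weightedSobolevInner α (ρ k)) (F m - F n)
      (F m - F n)).re with h | h
    · linarith
    · nlinarith [sq_pos_of_pos hε]
  · simp only [FormalTensor.eval_mapDomain]
    by_cases hθ : ∃ k, θ k = 0
    · obtain ⟨k, hk⟩ := hθ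
      have h0 : ∀ u : Fin d → ℝ → ℂ, ∏ k, T k (u k) (θ k) = 0 := fun u =>
        Finset.prod_eq_zero (Finset.mem_univ k) (by simp [T, cotTransform, circlePullback, hk])
      rw [toTorus, if_pos ⟨k, hk⟩]
      simp [h0]
    · rw [toTorus, if_neg hθ]
      push Not at hθ
      set t : Fin d → ℝ := fun k => (AddCircle.equivIco (2 * Real.pi) 0 (θ k) : ℝ) with ht
      have hsin : ∀ k, Real.sin (t k / 2) ≠ 0 := fun k => by
        have hmem := (AddCircle.equivIco (2 * Real.pi) 0 (θ k)).2
        refine sin_half_ne_zero ⟨lt_of_le_of_ne hmem.1 fun h => hθ k ?_, by simpa using hmem.2⟩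
        have := AddCircle.coe_equivIco (p := 2 * Real.pi) (a := 0) (y := θ k)
        rw [← this]
        change ((t k : ℝ) : Circ) = 0
        rw [← h, AddCircle.coe_zero]
      -- At a fixed point the weight and Jacobian factors do not depend on $u$, so they come out of
      -- the sum and the limit is that of $F_n$ at $\varphi_c(t)$.
      have hT : ∀ (u : Fin d → ℝ → ℂ), ∏ k, T k (u k) (θ k) =
          (∏ k, u k (mobiusMap c t k)) * (((∏ k, ρ k (mobiusMap c t k) : ℝ) : ℂ) *
            ((∏ k, c k * deriv mobius (t k) : ℝ) : ℂ)) := fun u => by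
        push_cast
        rw [← Finset.prod_mul_distrib, ← Finset.prod_mul_distrib]
        refine Finset.prod_congr rfl fun k _ => ?_
        have : T k (u k) (θ k) = (cotJacobian (c k) (mobiusMap c t k) * ρ k (mobiusMap c t k)) •
            u k (mobiusMap c t k) := by
          simp [T, cotTransform, circlePullback, hθ k, mobiusMap, ht]
        rw [this, mobiusMap, cotJacobian_cot (hc k) (hsin k), Complex.real_smul]
        push_cast
        ring
      have hsum : ∀ n, ((F n).sum fun u a => a * ∏ k, T k (u k) (θ k)) =
          (F n).eval (mobiusMap c t) * (((∏ k, ρ k (mobiusMap c t k) : ℝ) : ℂ) *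
            ((∏ k, c k * deriv mobius (t k) : ℝ) : ℂ)) := fun n => by
        simp only [hT, FormalTensor.eval, Finsupp.sum, Finset.sum_mul, mul_assoc]
      simp only [hsum, transformedIntegrand, mul_assoc]
      exact (hFlim (mobiusMap c t)).mul_const _
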